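/- Let $N$ be a random variable with values in $\{0,1,2,\dots\}$ and let $Q$, $C$ be non-negative real random variables. Let $\mathcal U=\bigcup_{n\ge 0}\{1,2,\dots\}^n$ be the set of finite sequences of positive integers (with $\emptyset$ the empty sequence), and let $\{N_v\}_{v\in\mathcal U}$, $\{Q_v\}_{v\in\mathcal U}$, $\{C_v\}_{v\in\mathcal U}$ be mutually independent families of i.i.d. copies of $N$, $Q$ and $C$, respectively. Put $A_0=\{\emptyset\}$ and $A_{n}=\{(i_1,\dots,i_n): (i_1,\dots,i_{n-1})\in A_{n-1},\ 1\le i_n\le N_{(i_1,\dots,i_{n-1})}\}$ for $n\ge1$, and define $$W_n=\sum_{(i_1,\dots,i_n)\in A_n} Q_{(i_1,\dots,i_n)}\prod_{k=1}^n C_{(i_1,\dots,i_k)}\quad(n\ge 0),\qquad R=\sum_{n=0}^\infty W_n\in[0,\infty].$$ Suppose that $P(Q>x)=x^{-\alpha}L(x)$ for all $x>0$, where $\alpha>1$ and $L:[0,\infty)\to(0,\infty)$ is slowly varying, i.e. $L(\lambda x)/L(x)\to1$ as $x\to\infty$ for every $\lambda>0$. Let $\rho=E[N]E[C]$ and $\rho_\alpha=E[N]E[C^\alpha]$.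 Assume that $\max\{\rho,\rho_\alpha\}<1$, and that $E[C^{\alpha+\epsilon}]<\infty$ and $E[N^{\alpha+\epsilon}]<\infty$ for some $\epsilon>0$. Then $$P(R>x)\sim(1-\rho_\alpha)^{-1}P(Q>x)\qquad\text{as }x\to\infty.$$ -/

import Mathlib

open MeasureTheory ProbabilityTheory Filter Asymptotics
open scoped NNReal ENNReal Topology

/-- `L : [0, ∞) → (0, ∞)` is slowly varying at infinity: `L (c x) / L x → 1` as `x → ∞` for
every `c > 0`. (The values of `L` on the negative half-line play no role.) -/
structure SlowlyVarying (L : ℝ → ℝ) : Prop where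
  pos : ∀ x, 0 ≤ x → 0 < L x
  tendsto : ∀ c, 0 < c → Tendsto (fun x => L (c * x) / L x) atTop (𝓝 1)

/-- Individuals of the tree are finite sequences `[i₁, …, iₙ]`, the root being `[]`; the children
of an individual `v` with `N v` children are `v ++ [0], …, v ++ [N v - 1]`. For a realization `N` of
the offspring numbers, `generation N n` is the set `Aₙ` of the individuals in generation `n`. -/
def generation (N : List ℕ → ℕ) : ℕ → Finset (List ℕ)
  | 0 => {[]}
  | n + 1 => (generation N n).biUnion fun v => (Finset.range (N v)).image fun i => v ++ [i]

/-- The weight of the individual `v = [i₁, …, iₙ]`: the product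
`C [i₁] * C [i₁, i₂] * ⋯ * C [i₁, …, iₙ]` along the branch from the root to `v`; the root has
weight `1`. -/
noncomputable def branchWeight (C : List ℕ → ℝ≥0) (v : List ℕ) : ℝ≥0 :=
  ∏ k ∈ Finset.range v.length, C (v.take (k + 1))

/-- The total weight `Wₙ` of generation `n`, for a realization of the offspring numbers `N`, the
innovations `Q` and the factors `C`. -/
noncomputable def generationWeight (N : List ℕ → ℕ) (Q C : List ℕ → ℝ≥0) (n : ℕ) : ℝ≥0 :=
  ∑ v ∈ generation N n, Q v * branchWeight C v

/-- The total weight `R = ∑ₙ Wₙ` of the tree, as an element of `[0, ∞]`. -/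
noncomputable def totalWeight (N : List ℕ → ℕ) (Q C : List ℕ → ℝ≥0) : ℝ≥0∞ :=
  ∑' n, (generationWeight N Q C n : ℝ≥0∞)

/-! `R` is the sum over `v` of `w_v Q_v`, where `w_v` is the product of the factors along the branch
to `v` if `v` lies in the tree and 0 otherwise. The weights are independent of the i.i.d. family
`Q_v`. A large value of such a sum is caused by one large summand, so P(R > x) ~ E Σ P(w_v Q > x) ~
P(Q > x) E Σ w_v^α. Generation n contributes ρ_α^n to the last expectation, and the geometric series
gives (1 - ρ_α)⁻¹.

Fubini freezes the weights (`measure_weighted_sum_eq_lintegral`). For fixed weights, Bonferroni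
bounds the tail from below (`tsum_measure_le_weighted_sum`). From above (`measure_weighted_sum_le`)
the errors are the probability of two moderately large summands and a Chernoff term of order (1 +
T)^γ x^(-γ), where T = Σ w_v and γ > α. Potter's bounds dominate P(w Q > x) / P(Q > x) by K (w +
w^γ), so dominated convergence carries the limit through the sum and the expectation
(`RegularTail.tendsto_expected_count`).

What remains is E T^γ < ∞ for some γ > α. By convexity of moments in the exponent, E[N] E[C^γ] stays
below 1 for some γ slightly above α, hence on all of [1, γ]. The partial sums of T satisfy the
recursion Z' = 1 + Σ_{i < N} C_i Z_i at the root. A leave-one-out estimate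
(`lintegral_random_sum_rpow_le`) turns it into a contraction for γ-th moments, up to a term
controlled by moments of order max(γ - 1, 1), and induction on the exponent concludes
(`boundedMoments`). -/

/-! ### Regularly varying tails -/

/-- `F` is positive, non-increasing and regularly varying at infinity with index `-α`. -/
structure RegularTail (F : ℝ → ℝ) (α : ℝ) : Prop where
  pos : ∀ x, 0 < x → 0 < F x
  anti : Antitone F
  tendsto : ∀ c, 0 < c → Tendsto (fun x => F (c * x) / F x) atTop (𝓝 (c ^ (-α)))

namespace RegularTail

variable {F : ℝ → ℝ} {α : ℝ}

theorem of_slowlyVarying {L : ℝ → ℝ} (hL : SlowlyVarying L) (hF : Antitone F)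
    (h : ∀ x, 0 < x → F x = x ^ (-α) * L x) : RegularTail F α where
  pos x hx := by
    rw [h x hx]
    exact mul_pos (Real.rpow_pos_of_pos hx _) (hL.pos x hx.le)
  anti := hF
  tendsto c hc := by
    have h1 := (hL.tendsto c hc).const_mul (c ^ (-α))
    rw [mul_one] at h1
    refine h1.congr' ?_
    filter_upwards [eventually_gt_atTop 0] with x hx
    have := Real.rpow_pos_of_pos hx (-α)
    have := hL.pos x hx.le
    rw [h x hx, h (c * x) (by positivity), Real.mul_rpow hc.le hx.le]
    field_simp

/-- Potter's bound from above. -/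
theorem potter_upper (hF : RegularTail F α) {a : ℝ} (ha0 : 0 ≤ a) (ha : a < α) :
    ∃ x₀ > 0, ∀ y ≥ x₀, ∀ c ≥ 1, F (c * y) ≤ 2 ^ a * c ^ (-a) * F y := by
  -- Only the ratio at 2 matters: its limit 2^(-α) lies strictly below 2^(-a), so each doubling
  -- eventually gains 2^(-a). Monotonicity fills the gaps between powers of two at the cost of the
  -- factor 2^a.
  have h1 : ∀ᶠ x in atTop, F (2 * x) / F x < 2 ^ (-a) :=
    (hF.tendsto 2 two_pos).eventually_lt_const
      (Real.rpow_lt_rpow_of_exponent_lt one_lt_two (by linarith))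
  obtain ⟨x₀, hx₀⟩ := (h1.and (eventually_gt_atTop 0)).exists_forall_of_atTop
  have hx0 : 0 < x₀ := (hx₀ x₀ le_rfl).2
  refine ⟨x₀, hx0, fun y hy c hc => ?_⟩
  have hiter : ∀ k : ℕ, F (2 ^ k * y) ≤ (2 ^ (-a)) ^ k * F y := by
    intro k
    induction k with
    | zero => simp
    | succ k ih =>
      have hk : (1 : ℝ) ≤ 2 ^ k := one_le_pow₀ one_le_two
      have hky : x₀ ≤ 2 ^ k * y := by nlinarith
      have h2 := (hx₀ _ hky).1
      rw [div_lt_iff₀ (hF.pos _ (hx0.trans_le hky))] at h2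
      calc F (2 ^ (k + 1) * y) = F (2 * (2 ^ k * y)) := by ring_nf
        _ ≤ 2 ^ (-a) * F (2 ^ k * y) := h2.le
        _ ≤ 2 ^ (-a) * ((2 ^ (-a)) ^ k * F y) := by gcongr
        _ = _ := by ring
  obtain ⟨k, hk1, hk2⟩ := exists_nat_pow_near hc one_lt_two
  have hy0 : 0 < y := hx0.trans_le hy
  calc F (c * y) ≤ F (2 ^ k * y) := hF.anti (by gcongr)
    _ ≤ (2 ^ (-a)) ^ k * F y := hiter k
    _ ≤ 2 ^ a * c ^ (-a) * F y := by
      refine mul_le_mul_of_nonneg_right ?_ (hF.pos y hy0).le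
      rw [← Real.rpow_natCast, ← Real.rpow_mul zero_le_two, mul_comm, Real.rpow_mul zero_le_two,
        Real.rpow_natCast]
      have h3 : (2 ^ (k + 1) : ℝ) ^ (-a) ≤ c ^ (-a) :=
        Real.rpow_le_rpow_of_nonpos (by linarith) hk2.le (by linarith)
      rw [pow_succ, Real.mul_rpow (by positivity) zero_le_two] at h3
      calc ((2 : ℝ) ^ k) ^ (-a) = 2 ^ a * ((2 ^ k : ℝ) ^ (-a) * 2 ^ (-a)) := by
            rw [Real.rpow_neg zero_le_two]
            have := Real.rpow_pos_of_pos two_pos a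
            field_simp
        _ ≤ _ := by gcongr

/-- Potter's bound from below. -/
theorem potter_lower (hF : RegularTail F α) {b : ℝ} (hb0 : 0 ≤ b) (hb : α < b) :
    ∃ x₀ > 0, ∀ y ≥ x₀, ∀ c ≥ 1, F y ≤ 2 ^ b * c ^ b * F (c * y) := by
  have h1 : ∀ᶠ x in atTop, 2 ^ (-b) < F (2 * x) / F x :=
    (hF.tendsto 2 two_pos).eventually_const_lt
      (Real.rpow_lt_rpow_of_exponent_lt one_lt_two (by linarith))
  obtain ⟨x₀, hx₀⟩ := (h1.and (eventually_gt_atTop 0)).exists_forall_of_atTop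
  have hx0 : 0 < x₀ := (hx₀ x₀ le_rfl).2
  refine ⟨x₀, hx0, fun y hy c hc => ?_⟩
  have hiter : ∀ k : ℕ, F y ≤ (2 ^ b) ^ k * F (2 ^ k * y) := by
    intro k
    induction k with
    | zero => simp
    | succ k ih =>
      have hk : (1 : ℝ) ≤ 2 ^ k := one_le_pow₀ one_le_two
      have hky : x₀ ≤ 2 ^ k * y := by nlinarith
      have h2 := (hx₀ _ hky).1
      rw [lt_div_iff₀ (hF.pos _ (hx0.trans_le hky)), Real.rpow_neg zero_le_two,
        inv_mul_lt_iff₀ (by positivity)] at h2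
      calc F y ≤ (2 ^ b) ^ k * F (2 ^ k * y) := ih
        _ ≤ (2 ^ b) ^ k * (2 ^ b * F (2 * (2 ^ k * y))) := by gcongr
        _ = (2 ^ b) ^ (k + 1) * F (2 ^ (k + 1) * y) := by ring_nf
  obtain ⟨k, hk1, hk2⟩ := exists_nat_pow_near hc one_lt_two
  have hy0 : 0 < y := hx0.trans_le hy
  have hcy := hF.pos (c * y) (by positivity)
  calc F y ≤ (2 ^ b) ^ (k + 1) * F (2 ^ (k + 1) * y) := hiter _
    _ ≤ (2 ^ b) ^ (k + 1) * F (c * y) := by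
      gcongr
      exact hF.anti (by gcongr)
    _ ≤ 2 ^ b * c ^ b * F (c * y) := by
      refine mul_le_mul_of_nonneg_right ?_ hcy.le
      rw [pow_succ', ← Real.rpow_natCast (2 ^ b) k, ← Real.rpow_mul zero_le_two, mul_comm b,
        Real.rpow_mul zero_le_two, Real.rpow_natCast]
      gcongr

/-- For `c ≤ 1` the upper Potter bound with exponent 1 gives the factor `c`; for `c ≥ 1` the lower
one gives `c ^ β`. Uniformity in `c` makes this the dominating function for random weights. -/
theorem le_rescale (hF : RegularTail F α) (hα : 1 < α) {β : ℝ} (hβ : α < β) :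
    ∃ K > 0, ∃ x₀ > 0, ∀ y ≥ x₀, ∀ c > 0, F (y / c) ≤ K * (c + c ^ β) * F y := by
  obtain ⟨x₁, hx₁, h₁⟩ := hF.potter_upper zero_le_one hα
  obtain ⟨x₂, hx₂, h₂⟩ := hF.potter_lower (b := β) (by linarith) hβ
  set x₀ := max x₁ x₂
  have hx0 : 0 < x₀ := lt_max_of_lt_left hx₁
  have hF0 := hF.pos x₀ hx0
  have h2 : (0 : ℝ) < 2 ^ β := by positivity
  -- `M` handles the arguments `y / c` below the Potter threshold, where only `F ≤ F 0` is
  -- available.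
  set M := F 0 / F x₀
  have hM : 1 ≤ M := by
    rw [one_le_div hF0]
    exact hF.anti hx0.le
  refine ⟨2 ^ (1 : ℝ) + 2 ^ β * M, by positivity, x₀, hx0, fun y hy c hc => ?_⟩
  have hy0 : 0 < y := hx0.trans_le hy
  have hFy := hF.pos y hy0
  have hcβ : 0 < c ^ β := Real.rpow_pos_of_pos hc _
  rcases le_total c 1 with hc1 | hc1
  · have h := h₁ y ((le_max_left _ _).trans hy) c⁻¹ ((one_le_inv₀ hc).2 hc1)
    rw [inv_mul_eq_div, Real.rpow_neg (by positivity), Real.rpow_one c⁻¹, inv_inv] at h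
    refine h.trans ?_
    gcongr
    · exact le_add_of_nonneg_right (by positivity)
    · linarith
  · have key : ∀ z, x₀ ≤ z → z ≤ y → y ≤ c * z → F z ≤ 2 ^ β * c ^ β * F y := by
      intro z hz hzy hcz
      have hz0 : 0 < z := hx0.trans_le hz
      have h := h₂ z ((le_max_right _ _).trans hz) (y / z) ((one_le_div hz0).2 hzy)
      rw [div_mul_cancel₀ _ hz0.ne'] at h
      refine h.trans ?_
      have : y / z ≤ c := (div_le_iff₀ hz0).2 hcz
      have : 0 ≤ β := by linarith
      gcongr
    have hz : F (y / c) ≤ 2 ^ β * M * c ^ β * F y := by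
      rcases le_total x₀ (y / c) with hz | hz
      · refine (key _ hz (div_le_self hy0.le hc1) (by rw [mul_div_cancel₀ _ hc.ne'])).trans ?_
        gcongr
        exact le_mul_of_one_le_right h2.le hM
      · have h := key x₀ le_rfl hy (by rwa [div_le_iff₀' hc] at hz)
        calc F (y / c) ≤ F 0 := hF.anti (by positivity)
          _ = M * F x₀ := (div_mul_cancel₀ _ hF0.ne').symm
          _ ≤ M * (2 ^ β * c ^ β * F y) := by gcongr
          _ = _ := by ring
    refine hz.trans ?_
    have h3 : (0 : ℝ) < 2 ^ (1 : ℝ) := by positivity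
    have h4 : 2 ^ β * M * c ^ β ≤ (2 ^ (1 : ℝ) + 2 ^ β * M) * (c + c ^ β) :=
      mul_le_mul (by linarith) (by linarith) hcβ.le (by positivity)
    exact mul_le_mul_of_nonneg_right h4 hFy.le

/-- By Potter's lower bound with an exponent strictly between `α` and `β`, `F` decays more slowly
than `x ^ (-β)`. This makes the Chernoff error negligible. -/
theorem tendsto_rpow_div (hF : RegularTail F α) (hα : 0 < α) {β : ℝ} (hβ : α < β) :
    Tendsto (fun x => x ^ (-β) / F x) atTop (𝓝 0) := by
  obtain ⟨b, hb1, hb2⟩ := exists_between hβ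
  obtain ⟨x₀, hx₀, h⟩ := hF.potter_lower (b := b) (by linarith) hb1
  have hF0 := hF.pos x₀ hx₀
  have hlim : Tendsto (fun x : ℝ => 2 ^ b * x₀ ^ (-b) / F x₀ * x ^ (-(β - b))) atTop (𝓝 0) := by
    simpa using (tendsto_rpow_neg_atTop (sub_pos.2 hb2)).const_mul (2 ^ b * x₀ ^ (-b) / F x₀)
  refine squeeze_zero' ?_ ?_ hlim
  · filter_upwards [eventually_gt_atTop 0] with x hx
    have := hF.pos x hx
    positivity
  · filter_upwards [eventually_ge_atTop x₀] with x hx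
    have hx0 : 0 < x := hx₀.trans_le hx
    have hFx := hF.pos x hx0
    have h1 := h x₀ le_rfl (x / x₀) ((one_le_div hx₀).2 hx)
    rw [div_mul_cancel₀ _ hx₀.ne', Real.div_rpow hx0.le hx₀.le, div_eq_mul_inv (x ^ b),
      ← Real.rpow_neg hx₀.le] at h1
    rw [div_le_iff₀ hFx, neg_sub, Real.rpow_sub hx0, Real.rpow_neg hx0.le]
    have : 0 < x ^ b := by positivity
    have : 0 < x ^ β := by positivity
    field_simp
    linarith

theorem tendsto_zero (hF : RegularTail F α) (hα : 1 < α) : Tendsto F atTop (𝓝 0) := by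
  obtain ⟨x₀, hx₀, h⟩ := hF.potter_upper zero_le_one hα
  have hlim : Tendsto (fun x : ℝ => 2 ^ (1 : ℝ) * x₀ * F x₀ * x⁻¹) atTop (𝓝 0) := by
    simpa using tendsto_inv_atTop_zero.const_mul (2 ^ (1 : ℝ) * x₀ * F x₀)
  refine squeeze_zero' ?_ ?_ hlim
  · filter_upwards [eventually_gt_atTop 0] with x hx using (hF.pos x hx).le
  · filter_upwards [eventually_ge_atTop x₀] with x hx
    have h1 := h x₀ le_rfl (x / x₀) ((one_le_div hx₀).2 hx)
    rw [div_mul_cancel₀ _ hx₀.ne', Real.rpow_neg (div_pos (hx₀.trans_le hx) hx₀).le,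
      Real.rpow_one (x / x₀),
      inv_div] at h1
    refine h1.trans_eq ?_
    ring

/-- A non-negative random variable with a regularly varying tail of index `-α`, `α > 1`,
has a finite mean. -/
theorem lintegral_ne_top {Ω : Type*} [MeasurableSpace Ω] {P : Measure Ω} [IsProbabilityMeasure P]
    {Q : Ω → ℝ≥0} (hQ : Measurable Q) (hF : RegularTail (fun x => P.real {ω | x < (Q ω : ℝ)}) α)
    (hα : 1 < α) : ∫⁻ ω, Q ω ∂P ≠ ∞ := by
  obtain ⟨a, ha1, ha2⟩ := exists_between hα
  obtain ⟨x₀, hx₀, h⟩ := hF.potter_upper (a := a) (by linarith) ha2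
  have h1 := lintegral_eq_lintegral_meas_lt P (f := fun ω => (Q ω : ℝ))
    (Eventually.of_forall fun ω => (Q ω).2) (by fun_prop)
  simp only [ENNReal.ofReal_coe_nnreal] at h1
  rw [h1, ← Set.Ioc_union_Ioi_eq_Ioi hx₀.le]
  refine ((lintegral_union_le _ _ _).trans_lt (ENNReal.add_lt_top.2 ⟨?_, ?_⟩)).ne
  · refine (lintegral_mono (g := fun _ => 1) fun t => prob_le_one).trans_lt ?_
    simp
  · set A := 2 ^ a * x₀ ^ a * P.real {ω | x₀ < (Q ω : ℝ)}
    have hint : IntegrableOn (fun t : ℝ => A * t ^ (-a)) (Set.Ioi x₀) :=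
      (integrableOn_Ioi_rpow_of_lt (by linarith) hx₀).const_mul _
    refine (setLIntegral_mono' measurableSet_Ioi fun t ht => ?_).trans_lt hint.lintegral_lt_top
    have ht' : x₀ < t := ht
    have ht0 : 0 < t := hx₀.trans ht'
    rw [← ofReal_measureReal]
    refine ENNReal.ofReal_le_ofReal ?_
    have h2 := h x₀ le_rfl (t / x₀) ((one_le_div hx₀).2 ht'.le)
    rw [div_mul_cancel₀ _ hx₀.ne', Real.div_rpow ht0.le hx₀.le, Real.rpow_neg hx₀.le,
      div_inv_eq_mul] at h2
    refine h2.trans_eq ?_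
    simp only [A]
    ring

end RegularTail

/-! ### Weighted sums of independent variables, deterministic weights -/

section Bonferroni

variable {Ω ι : Type*} [MeasurableSpace Ω] {P : Measure Ω} [Countable ι]
  {A : ι → Set Ω}

/-- A union bound over pairs gives S², and P ≤ 1 ≤ S covers the case S ≥ 1. The form S * min 1 S,
unlike S², is bounded by S, as dominated convergence over random weights will require. -/
theorem measure_two_events_le [IsProbabilityMeasure P]
    (hA : ∀ i j, i ≠ j → P (A i ∩ A j) = P (A i) * P (A j)) :
    P {ω | ∃ i j, i ≠ j ∧ ω ∈ A i ∧ ω ∈ A j} ≤ (∑' i, P (A i)) * min 1 (∑' i, P (A i)) := by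
  rcases le_total 1 (∑' i, P (A i)) with h | h
  · rw [min_eq_left h, mul_one]
    exact prob_le_one.trans h
  · rw [min_eq_right h]
    have hsub : {ω | ∃ i j, i ≠ j ∧ ω ∈ A i ∧ ω ∈ A j} ⊆
        ⋃ i, ⋃ j, {ω | i ≠ j ∧ ω ∈ A i ∩ A j} := by
      rintro ω ⟨i, j, hij, hi, hj⟩
      exact Set.mem_iUnion.2 ⟨i, Set.mem_iUnion.2 ⟨j, hij, hi, hj⟩⟩
    calc P {ω | ∃ i j, i ≠ j ∧ ω ∈ A i ∧ ω ∈ A j}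
        ≤ P (⋃ i, ⋃ j, {ω | i ≠ j ∧ ω ∈ A i ∩ A j}) := measure_mono hsub
      _ ≤ ∑' i, ∑' j, P {ω | i ≠ j ∧ ω ∈ A i ∩ A j} :=
        (measure_iUnion_le _).trans (ENNReal.tsum_le_tsum fun i => measure_iUnion_le _)
      _ ≤ ∑' i, ∑' j, P (A i) * P (A j) := by
        refine ENNReal.tsum_le_tsum fun i => ENNReal.tsum_le_tsum fun j => ?_
        by_cases hij : i = j
        · simp [hij]
        · rw [← hA i j hij]
          exact measure_mono fun ω h => h.2
      _ = _ := by simp_rw [ENNReal.tsum_mul_left, ENNReal.tsum_mul_right]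

theorem tsum_measure_le_measure_iUnion_add (hm : ∀ i, MeasurableSet (A i))
    (hA : ∀ i j, i ≠ j → P (A i ∩ A j) = P (A i) * P (A j)) :
    ∑' i, P (A i) ≤ P (⋃ i, A i) + (∑' i, P (A i)) * min 1 (∑' i, P (A i)) := by
  rcases le_total 1 (∑' i, P (A i)) with h | h
  · rw [min_eq_left h, mul_one]
    exact le_add_self
  · rw [min_eq_right h]
    -- The points of `A i` in no other `A j`: these sets are disjoint, and the rest of `A i` is
    -- covered by pairwise intersections.
    set B : ι → Set Ω := fun i => A i \ ⋃ j ∈ {j | j ≠ i}, A j with hB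
    have hBm : ∀ i, MeasurableSet (B i) := fun i =>
      (hm i).diff (MeasurableSet.biUnion (Set.to_countable _) fun j _ => hm j)
    have hBd : Pairwise (Function.onFun Disjoint B) := by
      intro i j hij
      refine Set.disjoint_left.2 fun ω hi hj => ?_
      exact hj.2 (Set.mem_biUnion (show i ∈ {k | k ≠ j} from hij) hi.1)
    have h1 : ∀ i, P (A i) ≤ P (B i) + ∑' j, P (A i) * P (A j) := by
      intro i
      have hsub : A i ⊆ B i ∪ ⋃ j, {ω | i ≠ j ∧ ω ∈ A i ∩ A j} := by
        intro ω hω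
        by_cases h : ω ∈ ⋃ j ∈ {j | j ≠ i}, A j
        · right
          obtain ⟨j, hj, hj'⟩ := Set.mem_iUnion₂.1 h
          exact Set.mem_iUnion.2 ⟨j, (Ne.symm hj : i ≠ j), hω, hj'⟩
        · exact Or.inl ⟨hω, h⟩
      refine (measure_mono hsub).trans ((measure_union_le _ _).trans ?_)
      gcongr
      refine (measure_iUnion_le _).trans (ENNReal.tsum_le_tsum fun j => ?_)
      by_cases hij : i = j
      · simp [hij]
      · rw [← hA i j hij]
        exact measure_mono fun ω h => h.2
    calc ∑' i, P (A i) ≤ ∑' i, (P (B i) + ∑' j, P (A i) * P (A j)) := ENNReal.tsum_le_tsum h1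
      _ = P (⋃ i, B i) + (∑' i, P (A i)) * ∑' i, P (A i) := by
        rw [ENNReal.tsum_add, measure_iUnion hBd hBm]
        simp_rw [ENNReal.tsum_mul_left, ENNReal.tsum_mul_right]
      _ ≤ _ := by
        gcongr with i
        exact Set.sdiff_subset

end Bonferroni

/-! ### Exponential Markov bound for sums of bounded variables -/

section Chernoff

variable {Ω ι : Type*} [MeasurableSpace Ω] {P : Measure Ω} [IsProbabilityMeasure P]
  {Y : ι → Ω → ℝ≥0}

/-- Markov's inequality for the product of the b^(Y_i / s) with b = 1 + s / M. Since Y_i / s lies in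
[0, 1], Bernoulli's inequality gives b^(Y_i / s) ≤ 1 + Y_i / M, so the product has mean at most
exp(Σ E Y_i / M) ≤ e. The threshold b^β is at least (s / M)^β. -/
theorem measure_lt_sum_le_of_bounded (hYi : iIndepFun Y P) (hYm : ∀ i, Measurable (Y i))
    {s M β : ℝ≥0} (hs : 0 < s) (hM : 0 < M) (hY : ∀ i ω, Y i ω ≤ s) (I : Finset ι)
    (hE : ∑ i ∈ I, ∫⁻ ω, Y i ω ∂P ≤ M) :
    P {ω | β * s < ∑ i ∈ I, Y i ω} ≤ ENNReal.ofReal (Real.exp 1 * (M / s) ^ (β : ℝ)) := by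
  have hs' : (0 : ℝ) < s := hs
  have hM' : (0 : ℝ) < M := hM
  set b : ℝ := 1 + s / M
  have hb : 1 < b := lt_add_of_pos_right _ (by positivity)
  have hb0 : 0 < b := by linarith
  set X : ι → Ω → ℝ≥0∞ := fun i ω => ENNReal.ofReal (b ^ ((Y i ω : ℝ) / s))
  have hg : Measurable fun y : ℝ≥0 => ENNReal.ofReal (b ^ ((y : ℝ) / s)) := by fun_prop
  have hX : iIndepFun X P := hYi.comp (fun _ => fun y => ENNReal.ofReal (b ^ ((y : ℝ) / s)))
    fun _ => hg
  have hXm : ∀ i, Measurable (X i) := fun i => hg.comp (hYm i)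
  have hX1 : ∀ i, ∫⁻ ω, X i ω ∂P ≤ 1 + (∫⁻ ω, Y i ω ∂P) / M := by
    intro i
    calc ∫⁻ ω, X i ω ∂P ≤ ∫⁻ ω, (1 + Y i ω / M) ∂P := by
          refine lintegral_mono fun ω => ?_
          have h1 := rpow_one_add_le_one_add_mul_self (s := s / M) (p := Y i ω / s)
            (by linarith [div_pos hs' hM']) (by positivity)
            ((div_le_one hs').2 (by exact_mod_cast hY i ω))
          have h2 : (Y i ω / s : ℝ) * (s / M) = Y i ω / M := by field_simp
          rw [h2] at h1
          refine (ENNReal.ofReal_le_ofReal h1).trans_eq ?_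
          rw [ENNReal.ofReal_add zero_le_one (by positivity), ENNReal.ofReal_one,
            ENNReal.ofReal_div_of_pos hM', ENNReal.ofReal_coe_nnreal, ENNReal.ofReal_coe_nnreal]
      _ = _ := by
        rw [lintegral_add_left measurable_const]
        simp [div_eq_mul_inv, lintegral_mul_const'' _ (hYm i).coe_nnreal_ennreal.aemeasurable]
  have hYfin : ∀ i ∈ I, ∫⁻ ω, Y i ω ∂P ≠ ∞ := fun i hi =>
    (lt_of_le_of_lt ((Finset.single_le_sum (f := fun i => ∫⁻ ω, Y i ω ∂P) (fun _ _ => zero_le)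
      hi).trans hE) ENNReal.coe_lt_top).ne
  have hprod : ∏ i ∈ I, ∫⁻ ω, X i ω ∂P ≤ ENNReal.ofReal (Real.exp 1) := by
    calc ∏ i ∈ I, ∫⁻ ω, X i ω ∂P
        ≤ ∏ i ∈ I, ENNReal.ofReal (Real.exp ((∫⁻ ω, Y i ω ∂P).toReal / M)) := by
          refine Finset.prod_le_prod' fun i hi => (hX1 i).trans ?_
          refine le_trans (le_of_eq ?_) (ENNReal.ofReal_le_ofReal (Real.add_one_le_exp _))
          rw [ENNReal.ofReal_add (by positivity) zero_le_one, ENNReal.ofReal_one,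
            ENNReal.ofReal_div_of_pos hM', ENNReal.ofReal_toReal (hYfin i hi),
            ENNReal.ofReal_coe_nnreal, add_comm]
      _ = ENNReal.ofReal (Real.exp ((∑ i ∈ I, ∫⁻ ω, Y i ω ∂P).toReal / M)) := by
          rw [← ENNReal.ofReal_prod_of_nonneg fun i _ => (Real.exp_pos _).le, ← Real.exp_sum,
            ENNReal.toReal_sum hYfin, Finset.sum_div]
      _ ≤ _ := by
          refine ENNReal.ofReal_le_ofReal (Real.exp_le_exp.2 ((div_le_one hM').2 ?_))
          exact ENNReal.toReal_le_of_le_ofReal hM'.le (by simpa using hE)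
  have hmarkov := mul_meas_ge_le_lintegral (μ := P)
    (f := fun ω => ∏ i ∈ I, X i ω) (Finset.measurable_fun_prod _ fun i _ => hXm i)
    (ENNReal.ofReal (b ^ (β : ℝ)))
  rw [lintegral_prod_eq_prod_lintegral_of_indepFun I X hX hXm] at hmarkov
  have hsub : {ω | β * s < ∑ i ∈ I, Y i ω} ⊆
      {ω | ENNReal.ofReal (b ^ (β : ℝ)) ≤ ∏ i ∈ I, X i ω} := by
    intro ω (hω : β * s < ∑ i ∈ I, Y i ω)
    simp only [Set.mem_ofPred_eq, X]
    rw [← ENNReal.ofReal_prod_of_nonneg fun i _ => by positivity, ← Real.rpow_sum_of_pos hb0]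
    refine ENNReal.ofReal_le_ofReal (Real.rpow_le_rpow_of_exponent_le hb.le ?_)
    rw [← Finset.sum_div, le_div_iff₀ hs']
    exact_mod_cast hω.le
  have hbβ : ((s : ℝ) / M) ^ (β : ℝ) ≤ b ^ (β : ℝ) := by
    refine Real.rpow_le_rpow (by positivity) ?_ β.2
    exact le_add_of_nonneg_left zero_le_one
  have hpos : (0 : ℝ) < ((s : ℝ) / M) ^ (β : ℝ) := by positivity
  have hfin : ENNReal.ofReal (((s : ℝ) / M) ^ (β : ℝ)) * P {ω | β * s < ∑ i ∈ I, Y i ω} ≤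
      ENNReal.ofReal (Real.exp 1) :=
    le_trans (mul_le_mul' (ENNReal.ofReal_le_ofReal hbβ) (measure_mono hsub))
      (hmarkov.trans hprod)
  rw [mul_comm, ← ENNReal.le_div_iff_mul_le (Or.inl (by simpa using hpos))
    (Or.inl ENNReal.ofReal_ne_top), ← ENNReal.ofReal_div_of_pos hpos] at hfin
  refine hfin.trans_eq ?_
  rw [div_eq_mul_inv, ← Real.inv_rpow (by positivity), inv_div]

theorem measure_lt_tsum_le_of_bounded [Countable ι] (hYi : iIndepFun Y P)
    (hYm : ∀ i, Measurable (Y i))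
    {s M β : ℝ≥0} (hs : 0 < s) (hM : 0 < M) (hY : ∀ i ω, Y i ω ≤ s)
    (hE : ∑' i, ∫⁻ ω, Y i ω ∂P ≤ M) :
    P {ω | (β * s : ℝ≥0∞) < ∑' i, (Y i ω : ℝ≥0∞)} ≤
      ENNReal.ofReal (Real.exp 1 * (M / s) ^ (β : ℝ)) := by
  have hU : {ω | (β * s : ℝ≥0∞) < ∑' i, (Y i ω : ℝ≥0∞)} =
      ⋃ I : Finset ι, {ω | β * s < ∑ i ∈ I, Y i ω} := by
    ext ω
    simp only [Set.mem_ofPred_eq, Set.mem_iUnion, ENNReal.tsum_eq_iSup_sum, lt_iSup_iff]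
    exact exists_congr fun I => by exact_mod_cast Iff.rfl
  rw [hU, Directed.measure_iUnion]
  · exact iSup_le fun I => measure_lt_sum_le_of_bounded hYi hYm hs hM hY I
      ((ENNReal.sum_le_tsum I).trans hE)
  · refine Monotone.directed_le fun I J hIJ ω hω => ?_
    exact lt_of_lt_of_le (show β * s < ∑ i ∈ I, Y i ω from hω) (Finset.sum_le_sum_of_subset hIJ)

end Chernoff

/-! ### One big jump for deterministic weights -/

section FixedWeights

variable {Ω ι : Type*} [MeasurableSpace Ω] {P : Measure Ω}
  {Q : ι → Ω → ℝ≥0}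

theorem measure_weighted_inter (hQi : iIndepFun Q P) (c : ι → ℝ≥0) (s : ℝ≥0) (i j : ι)
    (hij : i ≠ j) :
    P ({ω | s < c i * Q i ω} ∩ {ω | s < c j * Q j ω}) =
      P {ω | s < c i * Q i ω} * P {ω | s < c j * Q j ω} :=
  (hQi.indepFun hij).measure_inter_preimage_eq_mul {y | s < c i * y} {y | s < c j * y}
    (measurableSet_lt measurable_const (by fun_prop))
    (measurableSet_lt measurable_const (by fun_prop))

/-- The sum exceeds `x` as soon as one summand does, so the Bonferroni bound for the union applies.
-/
theorem tsum_measure_le_weighted_sum [Countable ι] (hQi : iIndepFun Q P)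
    (hQm : ∀ i, Measurable (Q i)) (c : ι → ℝ≥0) (x : ℝ≥0) :
    ∑' i, P {ω | x < c i * Q i ω} ≤ P {ω | (x : ℝ≥0∞) < ∑' i, (c i * Q i ω : ℝ≥0∞)} +
      (∑' i, P {ω | x < c i * Q i ω}) * min 1 (∑' i, P {ω | x < c i * Q i ω}) := by
  refine (tsum_measure_le_measure_iUnion_add (P := P) (A := fun i => {ω | x < c i * Q i ω})
    (fun i => measurableSet_lt measurable_const ((hQm i).const_mul _))
    (measure_weighted_inter hQi c x)).trans ?_
  gcongr
  refine Set.iUnion_subset fun i ω (hω : x < c i * Q i ω) => ?_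
  refine lt_of_lt_of_le ?_ (ENNReal.le_tsum i)
  exact_mod_cast hω

/-- If no two summands exceed `s`, all but at most one equal their truncations at `s`. If moreover
the exceptional one is at most `x` and the truncated sum at most `β * s`, the total is at most `x +
β * s`. The three terms bound the failures of these three conditions. -/
theorem measure_weighted_sum_le [Countable ι] [IsProbabilityMeasure P] (hQi : iIndepFun Q P)
    (hQm : ∀ i, Measurable (Q i)) (c : ι → ℝ≥0) {x s β M : ℝ≥0} (hs : 0 < s)
    (hM : 0 < M) (hE : ∑' i, c i * ∫⁻ ω, Q i ω ∂P ≤ M) :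
    P {ω | (x + β * s : ℝ≥0∞) < ∑' i, (c i * Q i ω : ℝ≥0∞)} ≤
      ∑' i, P {ω | x < c i * Q i ω} +
      (∑' i, P {ω | s < c i * Q i ω}) * min 1 (∑' i, P {ω | s < c i * Q i ω}) +
      ENNReal.ofReal (Real.exp 1 * (M / s) ^ (β : ℝ)) := by
  classical
  set Y : ι → Ω → ℝ≥0 := fun i ω => min (c i * Q i ω) s
  have hsub : {ω | (x + β * s : ℝ≥0∞) < ∑' i, (c i * Q i ω : ℝ≥0∞)} ⊆
      (⋃ i, {ω | x < c i * Q i ω}) ∪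
      {ω | ∃ i j, i ≠ j ∧ ω ∈ {ω | s < c i * Q i ω} ∧ ω ∈ {ω | s < c j * Q j ω}} ∪
      {ω | (β * s : ℝ≥0∞) < ∑' i, (Y i ω : ℝ≥0∞)} := by
    intro ω hω
    rw [Set.mem_ofPred_eq] at hω
    by_contra hcon
    simp only [Set.mem_union, Set.mem_iUnion, Set.mem_ofPred_eq, not_or, not_exists, not_lt,
      not_and] at hcon
    obtain ⟨⟨h1, h2⟩, h3⟩ := hcon
    refine hω.not_ge ?_
    have hone : ∀ u, (∀ v, v ≠ u → c v * Q v ω ≤ s) →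
        ∑' i, (c i * Q i ω : ℝ≥0∞) ≤ x + β * s := by
      intro u hu
      calc ∑' i, (c i * Q i ω : ℝ≥0∞) ≤ ∑' i, ((if i = u then (x : ℝ≥0∞) else 0) + Y i ω) := by
            refine ENNReal.tsum_le_tsum fun i => ?_
            by_cases hi : i = u
            · rw [if_pos hi]
              refine le_trans ?_ le_self_add
              exact_mod_cast h1 i
            · rw [if_neg hi, zero_add]
              simp only [Y]
              rw [min_eq_left (hu i hi), ENNReal.coe_mul]
        _ = x + ∑' i, (Y i ω : ℝ≥0∞) := by rw [ENNReal.tsum_add, tsum_ite_eq]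
        _ ≤ _ := by gcongr
    by_cases hex : ∃ u, s < c u * Q u ω
    · obtain ⟨u, hu⟩ := hex
      exact hone u fun v hv => h2 u v hv.symm hu
    · push Not at hex
      calc ∑' i, (c i * Q i ω : ℝ≥0∞) = ∑' i, (Y i ω : ℝ≥0∞) := by
            refine tsum_congr fun i => ?_
            simp only [Y]
            rw [min_eq_left (hex i), ENNReal.coe_mul]
        _ ≤ β * s := h3
        _ ≤ _ := le_add_self
  refine (measure_mono hsub).trans ((measure_union_le _ _).trans ?_)
  gcongr
  · refine (measure_union_le _ _).trans ?_
    gcongr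
    · exact measure_iUnion_le _
    · exact measure_two_events_le (measure_weighted_inter hQi c s)
  · refine measure_lt_tsum_le_of_bounded (Y := Y)
      (hQi.comp (fun i y => min (c i * y) s) fun i => by fun_prop)
      (fun i => by fun_prop) hs hM (fun i ω => min_le_right _ _) (le_trans ?_ hE)
    refine ENNReal.tsum_le_tsum fun i => ?_
    rw [← lintegral_const_mul _ (hQm i).coe_nnreal_ennreal]
    refine lintegral_mono fun ω => ?_
    have : Y i ω ≤ c i * Q i ω := min_le_left _ _
    rw [← ENNReal.coe_mul]
    exact ENNReal.coe_le_coe.2 this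

end FixedWeights

/-! ### Weighted sums of independent variables, random weights -/

theorem ENNReal.tsum_rpow_le_rpow_tsum {ι : Type*} (f : ι → ℝ≥0∞) {p : ℝ} (hp : 1 ≤ p) :
    ∑' i, f i ^ p ≤ (∑' i, f i) ^ p := by
  have h : ∀ y : ℝ≥0∞, y ^ p = y * y ^ (p - 1) := fun y => by
    conv_lhs => rw [← add_sub_cancel 1 p, ENNReal.rpow_add_of_nonneg _ _ zero_le_one (by linarith),
      ENNReal.rpow_one]
  rw [h (∑' i, f i), ← ENNReal.tsum_mul_right]
  refine ENNReal.tsum_le_tsum fun i => ?_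
  rw [h]
  exact mul_le_mul' le_rfl (ENNReal.rpow_le_rpow (ENNReal.le_tsum i) (by linarith))

theorem ENNReal.le_one_add_rpow (y : ℝ≥0∞) {p : ℝ} (hp : 1 ≤ p) : y ≤ 1 + y ^ p := by
  rcases le_total y 1 with h | h
  · exact h.trans le_self_add
  · refine le_trans ?_ le_add_self
    conv_lhs => rw [← ENNReal.rpow_one y]
    exact ENNReal.rpow_le_rpow_of_exponent_le h hp

/-! ### Rescaled tails of `Q` in extended non-negative form -/

section Tail

variable {Ω : Type*} [MeasurableSpace Ω] {P : Measure Ω} [IsProbabilityMeasure P]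
  {Q : Ω → ℝ≥0} {α : ℝ}

theorem measure_lt_mul_eq {c : ℝ≥0} (hc : 0 < c) (x : ℝ≥0) :
    P {ω | x < c * Q ω} = ENNReal.ofReal (P.real {ω | ((x : ℝ) / c) < (Q ω : ℝ)}) := by
  rw [ofReal_measureReal]
  congr 1
  ext ω
  have hc' : (0 : ℝ) < c := hc
  simp only [Set.mem_ofPred_eq]
  rw [div_lt_iff₀' hc']
  exact_mod_cast Iff.rfl

theorem measure_lt_eq (x : ℝ≥0) :
    P {ω | x < Q ω} = ENNReal.ofReal (P.real {ω | (x : ℝ) < (Q ω : ℝ)}) := by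
  simp

theorem RegularTail.measure_ne_zero
    (hF : RegularTail (fun x => P.real {ω | x < (Q ω : ℝ)}) α) {x : ℝ≥0} (hx : 0 < x) :
    P {ω | x < Q ω} ≠ 0 := by
  rw [measure_lt_eq]
  exact (ENNReal.ofReal_pos.2 (hF.pos x hx)).ne'

theorem RegularTail.tendsto_measure_div
    (hF : RegularTail (fun x => P.real {ω | x < (Q ω : ℝ)}) α) (hα : 0 < α) (c : ℝ≥0) :
    Tendsto (fun x : ℝ≥0 => P {ω | x < c * Q ω} / P {ω | x < Q ω}) atTop
      (𝓝 ((c : ℝ≥0∞) ^ α)) := by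
  rcases eq_or_ne c 0 with rfl | hc
  · simp [hα]
  have hc0 : 0 < c := pos_iff_ne_zero.2 hc
  have hc' : (0 : ℝ) < c := hc0
  have h1 := (hF.tendsto (c : ℝ)⁻¹ (by positivity)).comp (NNReal.tendsto_coe_atTop.2 tendsto_id)
  have h2 := ENNReal.tendsto_ofReal h1
  rw [Real.inv_rpow hc'.le, Real.rpow_neg hc'.le, inv_inv, ← ENNReal.ofReal_rpow_of_pos hc',
    ENNReal.ofReal_coe_nnreal] at h2
  refine h2.congr' ?_
  filter_upwards [eventually_gt_atTop 0] with x hx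
  rw [measure_lt_mul_eq hc0, measure_lt_eq, ← ENNReal.ofReal_div_of_pos (hF.pos x hx)]
  simp [div_eq_inv_mul]

theorem RegularTail.measure_lt_mul_le
    (hF : RegularTail (fun x => P.real {ω | x < (Q ω : ℝ)}) α) (hα : 1 < α) {β : ℝ}
    (hβ : α < β) : ∃ K : ℝ≥0, ∀ᶠ x : ℝ≥0 in atTop, ∀ c : ℝ≥0,
      P {ω | x < c * Q ω} / P {ω | x < Q ω} ≤ K * (c + (c : ℝ≥0∞) ^ β) := by
  obtain ⟨K, hK, x₀, hx₀, h⟩ := hF.le_rescale hα hβ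
  refine ⟨⟨K, hK.le⟩, ?_⟩
  filter_upwards [eventually_ge_atTop (⟨x₀, hx₀.le⟩ : ℝ≥0)] with x hx c
  rcases eq_or_ne c 0 with rfl | hc
  · simp
  have hc0 : 0 < c := pos_iff_ne_zero.2 hc
  have hc' : (0 : ℝ) < c := hc0
  have hx' : x₀ ≤ x := hx
  rw [measure_lt_mul_eq hc0, measure_lt_eq,
    ← ENNReal.ofReal_div_of_pos (hF.pos x (hx₀.trans_le hx'))]
  have h1 := h x hx' c hc'
  rw [← div_le_iff₀ (hF.pos x (hx₀.trans_le hx'))] at h1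
  refine (ENNReal.ofReal_le_ofReal h1).trans_eq ?_
  rw [ENNReal.ofReal_mul hK.le, ENNReal.ofReal_add hc'.le (by positivity),
    ← ENNReal.ofReal_rpow_of_pos hc', ENNReal.ofReal_coe_nnreal]
  congr 1
  exact ENNReal.ofReal_eq_coe_nnreal hK.le

theorem RegularTail.tendsto_rpow_div_measure
    (hF : RegularTail (fun x => P.real {ω | x < (Q ω : ℝ)}) α) (hα : 0 < α) {β : ℝ}
    (hβ : α < β) :
    Tendsto (fun x : ℝ≥0 => (x : ℝ≥0∞) ^ (-β) / P {ω | x < Q ω}) atTop (𝓝 0) := by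
  have h1 := (hF.tendsto_rpow_div hα hβ).comp (NNReal.tendsto_coe_atTop.2 tendsto_id)
  have h2 := ENNReal.tendsto_ofReal h1
  rw [ENNReal.ofReal_zero] at h2
  refine h2.congr' ?_
  filter_upwards [eventually_gt_atTop 0] with x hx
  have hx' : (0 : ℝ) < x := hx
  rw [measure_lt_eq, ← ENNReal.ofReal_coe_nnreal (p := x), ENNReal.ofReal_rpow_of_pos hx',
    ← ENNReal.ofReal_div_of_pos (hF.pos x hx)]
  simp

end Tail

theorem ENNReal.tendsto_tsum_of_dominated {ι X : Type*} [Countable ι] {l : Filter X}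
    [l.IsCountablyGenerated] {f : X → ι → ℝ≥0∞} {g b : ι → ℝ≥0∞} (hb : ∑' i, b i ≠ ∞)
    (hfb : ∀ᶠ x in l, ∀ i, f x i ≤ b i) (hf : ∀ i, Tendsto (fun x => f x i) l (𝓝 (g i))) :
    Tendsto (fun x => ∑' i, f x i) l (𝓝 (∑' i, g i)) := by
  let _ : MeasurableSpace ι := ⊤
  simp_rw [← lintegral_count]
  rw [← lintegral_count] at hb
  exact tendsto_lintegral_filter_of_dominated_convergence b
    (Eventually.of_forall fun x => measurable_from_top)
    (hfb.mono fun x hx => Eventually.of_forall hx) hb (Eventually.of_forall hf)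

theorem measurable_measure_lt_mul {Ω : Type*} [MeasurableSpace Ω] {P : Measure Ω} {Q : Ω → ℝ≥0}
    (x : ℝ≥0) : Measurable fun c : ℝ≥0 => P {ω | x < c * Q ω} := by
  refine Monotone.measurable fun c d hcd => measure_mono fun ω hω => ?_
  exact lt_of_lt_of_le (show x < c * Q ω from hω) (by gcongr)

/-! ### One big jump for random weights -/

section RandomWeights

variable {Ω ι : Type*} [MeasurableSpace Ω] {P : Measure Ω} [IsProbabilityMeasure P] [Countable ι]
  {Q : Ω → ℝ≥0} {α β : ℝ} {w : ι → Ω → ℝ≥0}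

/-- The rescaling bound K (w + w^β) sums over `i` to at most K (1 + 2 T^β), where T is the sum of
the weights; this is integrable and does not depend on `x`. -/
theorem RegularTail.exists_dominating
    (hF : RegularTail (fun x => P.real {ω | x < (Q ω : ℝ)}) α) (hα : 1 < α) (hβ : α < β)
    (hw : ∀ i, Measurable (w i)) (hT : ∫⁻ ω, (∑' i, (w i ω : ℝ≥0∞)) ^ β ∂P ≠ ∞) :
    ∃ b : ι → Ω → ℝ≥0∞, ∫⁻ ω, ∑' i, b i ω ∂P ≠ ∞ ∧ (∀ i, Measurable (b i)) ∧
      ∀ᶠ x : ℝ≥0 in atTop, ∀ ω i, P {ω' | x < w i ω * Q ω'} / P {ω | x < Q ω} ≤ b i ω := by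
  obtain ⟨K, hK⟩ := hF.measure_lt_mul_le hα hβ
  refine ⟨fun i ω => K * (w i ω + (w i ω : ℝ≥0∞) ^ β), ?_, fun i => by fun_prop,
    hK.mono fun x hx ω i => hx _⟩
  have hle : ∀ ω, ∑' i, K * (w i ω + (w i ω : ℝ≥0∞) ^ β) ≤
      K * (1 + 2 * (∑' i, (w i ω : ℝ≥0∞)) ^ β) := by
    intro ω
    rw [ENNReal.tsum_mul_left, ENNReal.tsum_add, two_mul, ← add_assoc]
    gcongr
    · exact ENNReal.le_one_add_rpow _ (by linarith)
    · exact ENNReal.tsum_rpow_le_rpow_tsum _ (by linarith)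
  refine ((lintegral_mono hle).trans_lt ?_).ne
  rw [lintegral_const_mul _ (by fun_prop), lintegral_add_left measurable_const,
    lintegral_const_mul _ (by fun_prop)]
  simp only [lintegral_const, measure_univ, mul_one]
  exact ENNReal.mul_lt_top ENNReal.coe_lt_top
    (ENNReal.add_lt_top.2 ⟨ENNReal.one_lt_top, ENNReal.mul_lt_top (by simp) hT.lt_top⟩)

/-- Dominated convergence is used twice, over the indices for fixed weights and then over the
weights. The last limit, for pairs of large summands, has the same dominating function; its extra
factor min 1 S tends to 0 pointwise. -/
theorem RegularTail.tendsto_expected_count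
    (hF : RegularTail (fun x => P.real {ω | x < (Q ω : ℝ)}) α) (hα : 1 < α) (hβ : α < β)
    (hw : ∀ i, Measurable (w i)) (hT : ∫⁻ ω, (∑' i, (w i ω : ℝ≥0∞)) ^ β ∂P ≠ ∞) :
    ∫⁻ ω, ∑' i, (w i ω : ℝ≥0∞) ^ α ∂P ≠ ∞ ∧
    Tendsto (fun x : ℝ≥0 => (∫⁻ ω, ∑' i, P {ω' | x < w i ω * Q ω'} ∂P) / P {ω | x < Q ω}) atTop
      (𝓝 (∫⁻ ω, ∑' i, (w i ω : ℝ≥0∞) ^ α ∂P)) ∧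
    Tendsto (fun x : ℝ≥0 => (∫⁻ ω, (∑' i, P {ω' | x < w i ω * Q ω'}) *
      min 1 (∑' i, P {ω' | x < w i ω * Q ω'}) ∂P) / P {ω | x < Q ω}) atTop (𝓝 0) := by
  obtain ⟨b, hb, hbm, hdom⟩ := hF.exists_dominating hα hβ hw hT
  have hm : ∀ x : ℝ≥0, Measurable fun ω => ∑' i, P {ω' | x < w i ω * Q ω'} := fun x =>
    Measurable.tsum fun i => (measurable_measure_lt_mul x).comp (hw i)
  have hm' : ∀ x : ℝ≥0, Measurable fun ω => (∑' i, P {ω' | x < w i ω * Q ω'}) *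
      min 1 (∑' i, P {ω' | x < w i ω * Q ω'}) := fun x => (hm x).mul (measurable_const.min (hm x))
  have hbfin : ∀ᵐ ω ∂P, ∑' i, b i ω < ∞ := ae_lt_top (Measurable.tsum hbm) hb
  have hpt : ∀ᵐ ω ∂P, Tendsto (fun x : ℝ≥0 =>
      (∑' i, P {ω' | x < w i ω * Q ω'}) / P {ω | x < Q ω}) atTop
      (𝓝 (∑' i, (w i ω : ℝ≥0∞) ^ α)) := by
    filter_upwards [hbfin] with ω hω
    simp_rw [div_eq_mul_inv, ← ENNReal.tsum_mul_right, ← div_eq_mul_inv]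
    exact ENNReal.tendsto_tsum_of_dominated hω.ne (hdom.mono fun x hx i => hx ω i)
      fun i => hF.tendsto_measure_div (by linarith) _
  have hle : ∀ᶠ x : ℝ≥0 in atTop, ∀ ω,
      (∑' i, P {ω' | x < w i ω * Q ω'}) / P {ω | x < Q ω} ≤ ∑' i, b i ω := by
    filter_upwards [hdom] with x hx ω
    rw [div_eq_mul_inv, ← ENNReal.tsum_mul_right]
    exact ENNReal.tsum_le_tsum fun i => hx ω i
  have hlim := tendsto_lintegral_filter_of_dominated_convergence (μ := P) (fun ω => ∑' i, b i ω)
    (F := fun (x : ℝ≥0) ω => (∑' i, P {ω' | x < w i ω * Q ω'}) / P {ω | x < Q ω})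
    (Eventually.of_forall fun x => (hm x).div_const _)
    (hle.mono fun x hx => Eventually.of_forall hx) hb hpt
  refine ⟨?_, ?_, ?_⟩
  · refine ((lintegral_mono_ae ?_).trans_lt hb.lt_top).ne
    filter_upwards [hpt] with ω hω
    exact le_of_tendsto hω (hle.mono fun x hx => hx ω)
  · refine hlim.congr fun x => ?_
    simp_rw [div_eq_mul_inv]
    rw [lintegral_mul_const _ (hm x)]
  · have hF0 : Tendsto (fun x : ℝ≥0 => P {ω | x < Q ω}) atTop (𝓝 0) := by
      have h1 := ENNReal.tendsto_ofReal
        ((hF.tendsto_zero hα).comp (NNReal.tendsto_coe_atTop.2 tendsto_id))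
      rw [ENNReal.ofReal_zero] at h1
      exact h1.congr fun x => measure_lt_eq x |>.symm
    have hlim0 := tendsto_lintegral_filter_of_dominated_convergence (μ := P)
      (fun ω => ∑' i, b i ω) (f := fun _ => 0)
      (F := fun (x : ℝ≥0) ω => (∑' i, P {ω' | x < w i ω * Q ω'}) / P {ω | x < Q ω} *
        min 1 (∑' i, P {ω' | x < w i ω * Q ω'}))
      (Eventually.of_forall fun x => ((hm x).div_const _).mul (measurable_const.min (hm x)))
      (hle.mono fun x hx => Eventually.of_forall fun ω =>
        (mul_le_of_le_one_right' (min_le_left _ _)).trans (hx ω)) hb ?_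
    · rw [lintegral_zero] at hlim0
      refine hlim0.congr fun x => ?_
      simp_rw [div_eq_mul_inv, mul_right_comm _ (P {ω | x < Q ω})⁻¹]
      rw [lintegral_mul_const _ (hm' x)]
    · filter_upwards [hpt, hbfin] with ω hω hbω
      have hfin : ∑' i, (w i ω : ℝ≥0∞) ^ α ≠ ∞ :=
        (lt_of_le_of_lt (le_of_tendsto hω (hle.mono fun x hx => hx ω)) hbω).ne
      -- The count is its ratio to P(Q > x), which has a finite limit, times P(Q > x), which tends
      -- to 0.
      have h1 : Tendsto (fun x : ℝ≥0 => ∑' i, P {ω' | x < w i ω * Q ω'}) atTop (𝓝 0) := by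
        have h2 := ENNReal.Tendsto.mul hω (Or.inr ENNReal.zero_ne_top) hF0 (Or.inr hfin)
        rw [mul_zero] at h2
        refine h2.congr' ?_
        filter_upwards [eventually_gt_atTop 0] with x hx
        exact ENNReal.div_mul_cancel (hF.measure_ne_zero hx) (measure_ne_top _ _)
      have h3 := ENNReal.Tendsto.mul hω (Or.inr (by simp))
        ((tendsto_const_nhds (x := (1 : ℝ≥0∞))).min h1)
        (Or.inr hfin)
      simpa using h3

/-- Independence makes the joint law of weights and variables a product measure, so Tonelli's
theorem allows the weights to be frozen. -/
theorem measure_weighted_sum_eq_lintegral {Qt : ι → Ω → ℝ≥0} (hw : ∀ i, Measurable (w i))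
    (hQm : ∀ i, Measurable (Qt i))
    (hind : IndepFun (fun ω i => w i ω) (fun ω i => Qt i ω) P) (x : ℝ≥0) :
    Measurable (fun ω => P {ω' | (x : ℝ≥0∞) < ∑' i, (w i ω * Qt i ω' : ℝ≥0∞)}) ∧
    P {ω | (x : ℝ≥0∞) < ∑' i, (w i ω * Qt i ω : ℝ≥0∞)} =
      ∫⁻ ω, P {ω' | (x : ℝ≥0∞) < ∑' i, (w i ω * Qt i ω' : ℝ≥0∞)} ∂P := by
  have hW : Measurable fun ω i => w i ω := measurable_pi_lambda _ hw
  have hQ : Measurable fun ω i => Qt i ω := measurable_pi_lambda _ hQm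
  set B : Set ((ι → ℝ≥0) × (ι → ℝ≥0)) := {p | (x : ℝ≥0∞) < ∑' i, (p.1 i * p.2 i : ℝ≥0∞)}
  have hB : MeasurableSet B := measurableSet_lt measurable_const (by fun_prop)
  have h := (indepFun_iff_map_prod_eq_prod_map_map hW.aemeasurable hQ.aemeasurable).1 hind
  have hsec := measurable_measure_prodMk_left (ν := P.map fun ω i => Qt i ω) hB
  have h3 : ∀ ω, (P.map fun ω i => Qt i ω) (Prod.mk (fun i => w i ω) ⁻¹' B) =
      P {ω' | (x : ℝ≥0∞) < ∑' i, (w i ω * Qt i ω' : ℝ≥0∞)} := fun ω =>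
    Measure.map_apply hQ (measurable_prodMk_left hB)
  have h2 := congrArg (fun ν => ν B) h
  rw [Measure.map_apply (hW.prodMk hQ) hB, Measure.prod_apply hB, lintegral_map hsec hW] at h2
  simp_rw [h3] at h2
  refine ⟨?_, h2⟩
  simp_rw [← h3]
  exact hsec.comp hW

/-- The tail of a randomly weighted sum of i.i.d. regularly varying variables. -/
theorem RegularTail.tendsto_weighted_sum {Qt : ι → Ω → ℝ≥0} (hQ : Measurable Q)
    (hF : RegularTail (fun x => P.real {ω | x < (Q ω : ℝ)}) α) (hα : 1 < α) (hβ : α < β)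
    (hw : ∀ i, Measurable (w i)) (hT : ∫⁻ ω, (∑' i, (w i ω : ℝ≥0∞)) ^ β ∂P ≠ ∞)
    (hQm : ∀ i, Measurable (Qt i)) (hQi : iIndepFun Qt P) (hQd : ∀ i, IdentDistrib (Qt i) Q P P)
    (hind : IndepFun (fun ω i => w i ω) (fun ω i => Qt i ω) P) :
    Tendsto (fun x : ℝ≥0 => P {ω | (x : ℝ≥0∞) < ∑' i, (w i ω * Qt i ω : ℝ≥0∞)} /
      P {ω | x < Q ω}) atTop (𝓝 (∫⁻ ω, ∑' i, (w i ω : ℝ≥0∞) ^ α ∂P)) := by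
  have hfub := measure_weighted_sum_eq_lintegral hw hQm hind
  have hid : ∀ (x c : ℝ≥0) i, P {ω | x < c * Qt i ω} = P {ω | x < c * Q ω} := fun x c i =>
    (hQd i).measure_mem_eq (s := {y | x < c * y}) (measurableSet_lt measurable_const (by fun_prop))
  have hmG : ∀ (a x : ℝ≥0), Measurable fun ω => ∑' i, P {ω' | x < a * w i ω * Q ω'} := fun a x =>
    Measurable.tsum fun i => (measurable_measure_lt_mul x).comp ((hw i).const_mul a)
  obtain ⟨hm, hA, hB⟩ := hF.tendsto_expected_count hα hβ hw hT
  set m := ∫⁻ ω, ∑' i, (w i ω : ℝ≥0∞) ^ α ∂P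
  have hscale : ∀ a : ℝ≥0, ∫⁻ ω, (∑' i, ((a * w i ω : ℝ≥0) : ℝ≥0∞)) ^ β ∂P ≠ ∞ := by
    intro a
    simp_rw [ENNReal.coe_mul, ENNReal.tsum_mul_left,
      ENNReal.mul_rpow_of_nonneg _ _ (show 0 ≤ β by linarith)]
    rw [lintegral_const_mul _ (by fun_prop)]
    exact ENNReal.mul_ne_top (ENNReal.rpow_ne_top_of_nonneg (by linarith) ENNReal.coe_ne_top) hT
  refine tendsto_order.2 ⟨fun l hl => ?_, fun u hu => ?_⟩
  · have h1 := ENNReal.Tendsto.sub hA hB (Or.inl hm)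
    rw [tsub_zero] at h1
    filter_upwards [h1.eventually_const_lt hl] with x hx
    refine hx.trans_le ?_
    rw [tsub_le_iff_right, ENNReal.div_add_div_same]
    gcongr
    rw [(hfub x).2, ← lintegral_add_left (hfub x).1]
    refine lintegral_mono fun ω => ?_
    have := tsum_measure_le_weighted_sum hQi hQm (fun i => w i ω) x
    simpa only [hid] using this
  -- The big jump is only known to exceed `x / a`, which costs a factor `a ^ α`; hence `a > 1` is
  -- taken close to 1.
  · have hcont : Tendsto (fun a : ℝ≥0 => (a : ℝ≥0∞) ^ α * m) (𝓝[>] 1) (𝓝 m) := by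
      have h1 : Tendsto (fun a : ℝ≥0 => (a : ℝ≥0∞) ^ α * m) (𝓝 1)
          (𝓝 (((1 : ℝ≥0) : ℝ≥0∞) ^ α * m)) :=
        ENNReal.Tendsto.mul_const
          ((ENNReal.continuous_rpow_const.comp ENNReal.continuous_coe).tendsto 1) (Or.inr hm)
      simp only [ENNReal.coe_one, ENNReal.one_rpow, one_mul] at h1
      exact h1.mono_left nhdsWithin_le_nhds
    obtain ⟨a, ha, ha1⟩ := ((hcont.eventually_lt_const hu).and self_mem_nhdsWithin).exists
    have ha1 : 1 < a := ha1
    have ha0 : 0 < a := one_pos.trans ha1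
    -- The level splits as x = p x + q x. The big jump has to exceed p x, and the truncated sum q x
    -- = B s with s = x / e, which dictates e = B / q.
    set p := a⁻¹
    have hp : 0 < p := inv_pos.2 ha0
    have hp1 : p < 1 := inv_lt_one_of_one_lt₀ ha1
    set q := 1 - p
    have hq : 0 < q := tsub_pos_of_lt hp1
    have hpq : p + q = 1 := add_tsub_cancel_of_le hp1.le
    set B : ℝ≥0 := β.toNNReal
    have hBβ : (B : ℝ) = β := Real.coe_toNNReal _ (by linarith)
    have hB0 : 0 < B := Real.toNNReal_pos.2 (by linarith)
    set e := B / q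
    have he : 0 < e := div_pos hB0 hq
    obtain ⟨-, hA1, -⟩ := hF.tendsto_expected_count hα hβ (w := fun i ω => a * w i ω)
      (fun i => (hw i).const_mul a) (hscale a)
    obtain ⟨-, -, hB2⟩ := hF.tendsto_expected_count hα hβ (w := fun i ω => e * w i ω)
      (fun i => (hw i).const_mul e) (hscale e)
    have hμ : ∫⁻ ω, Q ω ∂P ≠ ∞ := hF.lintegral_ne_top hQ hα
    set μ : ℝ≥0 := (∫⁻ ω, Q ω ∂P).toNNReal
    have hμ' : ∫⁻ ω, Q ω ∂P = μ := (ENNReal.coe_toNNReal hμ).symm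
    -- With M = (μ + 1)(1 + T) and s = x / e, the Chernoff term exp(1) (M / s)^β equals D x^(-β) (1
    -- + T)^β. The added ones keep M positive.
    set D : ℝ≥0∞ := ENNReal.ofReal (Real.exp 1) * (((μ + 1) * e : ℝ≥0) : ℝ≥0∞) ^ β
    have hD : D ≠ ∞ := ENNReal.mul_ne_top ENNReal.ofReal_ne_top
      (ENNReal.rpow_ne_top_of_nonneg (by linarith) ENNReal.coe_ne_top)
    have hD0 : D ≠ 0 := by
      refine mul_ne_zero (by simp [Real.exp_pos]) ?_
      have : 0 < (μ + 1) * e := by positivity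
      exact (ENNReal.rpow_pos (by exact_mod_cast this) ENNReal.coe_ne_top).ne'
    have hT1 : ∫⁻ ω, (1 + ∑' i, (w i ω : ℝ≥0∞)) ^ β ∂P ≠ ∞ := by
      have h1 : ∀ ω, (1 + ∑' i, (w i ω : ℝ≥0∞)) ^ β ≤
          2 ^ (β - 1) * (1 + (∑' i, (w i ω : ℝ≥0∞)) ^ β) := fun ω => by
        simpa using ENNReal.rpow_add_le_mul_rpow_add_rpow 1 (∑' i, (w i ω : ℝ≥0∞))
          (show 1 ≤ β by linarith)
      refine ((lintegral_mono h1).trans_lt ?_).ne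
      rw [lintegral_const_mul _ (by fun_prop), lintegral_add_left measurable_const]
      simp only [lintegral_const, measure_univ, mul_one]
      exact ENNReal.mul_lt_top (ENNReal.rpow_lt_top_of_nonneg (by linarith) (by simp))
        (ENNReal.add_lt_top.2 ⟨ENNReal.one_lt_top, hT.lt_top⟩)
    have hbound : ∀ x : ℝ≥0, 0 < x → ∀ ω,
        P {ω' | (x : ℝ≥0∞) < ∑' i, (w i ω * Qt i ω' : ℝ≥0∞)} ≤
        ∑' i, P {ω' | x < a * w i ω * Q ω'} + (∑' i, P {ω' | x < e * w i ω * Q ω'}) *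
          min 1 (∑' i, P {ω' | x < e * w i ω * Q ω'}) +
        D * (x : ℝ≥0∞) ^ (-β) * (1 + ∑' i, (w i ω : ℝ≥0∞)) ^ β := by
      intro x hx ω
      rcases eq_or_ne (∑' i, (w i ω : ℝ≥0∞)) ∞ with htop | htop
      · have hx' : (x : ℝ≥0∞) ^ (-β) ≠ 0 :=
          (ENNReal.rpow_pos (by exact_mod_cast hx) ENNReal.coe_ne_top).ne'
        rw [htop, add_top, ENNReal.top_rpow_of_pos (by linarith),
          ENNReal.mul_top (mul_ne_zero hD0 hx'), add_top]
        exact le_top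
      · set T : ℝ≥0 := (∑' i, (w i ω : ℝ≥0∞)).toNNReal
        have hTT : ∑' i, (w i ω : ℝ≥0∞) = T := (ENNReal.coe_toNNReal htop).symm
        have hs : 0 < x / e := div_pos hx he
        have h1 := measure_weighted_sum_le hQi hQm (fun i => w i ω) (x := p * x) (s := x / e)
          (β := B) (M := (μ + 1) * (1 + T)) hs (by positivity) (by
            simp_rw [show ∀ i, ∫⁻ ω, Qt i ω ∂P = μ from fun i => by
              rw [← hμ']
              exact ((hQd i).comp measurable_coe_nnreal_ennreal).lintegral_eq]
            rw [ENNReal.tsum_mul_right, hTT, mul_comm]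
            norm_cast
            gcongr
            · exact le_self_add
            · exact le_add_self)
        have hx1 : p * x + B * (x / e) = x := by
          have : B * (x / e) = q * x := by
            simp only [e]
            field_simp
          rw [this, ← add_mul, hpq, one_mul]
        have hx2 : ((p * x : ℝ≥0) : ℝ≥0∞) + B * ((x / e : ℝ≥0) : ℝ≥0∞) = x := by
          exact_mod_cast hx1
        rw [hx2] at h1
        simp_rw [hid] at h1
        have ha' : ∀ ω' i, p * x < w i ω * Q ω' ↔ x < a * w i ω * Q ω' := fun ω' i => by
          rw [mul_assoc, ← lt_inv_mul_iff₀ hp, inv_inv]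
        have he' : ∀ ω' i, x / e < w i ω * Q ω' ↔ x < e * w i ω * Q ω' := fun ω' i => by
          rw [mul_assoc, div_lt_iff₀' he]
        simp_rw [ha', he'] at h1
        refine h1.trans_eq ?_
        congr 1
        rw [hTT, hBβ, ENNReal.ofReal_mul (Real.exp_pos 1).le, ← NNReal.coe_div,
          ← ENNReal.ofReal_rpow_of_nonneg (NNReal.coe_nonneg _) (by linarith),
          ENNReal.ofReal_coe_nnreal, ENNReal.rpow_neg, ← ENNReal.inv_rpow,
          ← ENNReal.coe_inv hx.ne', mul_assoc, mul_assoc]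
        congr 1
        rw [← ENNReal.coe_one, ← ENNReal.coe_add,
          ← ENNReal.mul_rpow_of_nonneg _ _ (show 0 ≤ β by linarith),
          ← ENNReal.mul_rpow_of_nonneg _ _ (show 0 ≤ β by linarith), ← ENNReal.coe_mul,
          ← ENNReal.coe_mul]
        congr 2
        field_simp
    have hlim : Tendsto (fun x : ℝ≥0 =>
        (∫⁻ ω, ∑' i, P {ω' | x < a * w i ω * Q ω'} ∂P) / P {ω | x < Q ω} +
        (∫⁻ ω, (∑' i, P {ω' | x < e * w i ω * Q ω'}) *
          min 1 (∑' i, P {ω' | x < e * w i ω * Q ω'}) ∂P) / P {ω | x < Q ω} +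
        D * (∫⁻ ω, (1 + ∑' i, (w i ω : ℝ≥0∞)) ^ β ∂P) *
          ((x : ℝ≥0∞) ^ (-β) / P {ω | x < Q ω})) atTop (𝓝 ((a : ℝ≥0∞) ^ α * m)) := by
      have h3 := ENNReal.Tendsto.const_mul (hF.tendsto_rpow_div_measure (by linarith) hβ)
        (Or.inr (ENNReal.mul_ne_top hD hT1))
      have h4 := (hA1.add hB2).add h3
      rw [mul_zero, add_zero, add_zero] at h4
      convert h4 using 2
      simp_rw [ENNReal.coe_mul, ENNReal.mul_rpow_of_nonneg _ _ (show 0 ≤ α by linarith),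
        ENNReal.tsum_mul_left]
      rw [lintegral_const_mul _ (by fun_prop)]
    filter_upwards [hlim.eventually_lt_const ha, eventually_gt_atTop 0] with x hx hx0
    refine lt_of_le_of_lt ?_ hx
    rw [(hfub x).2]
    refine (ENNReal.div_le_div_right (lintegral_mono (hbound x hx0)) _).trans_eq ?_
    have hmG' : Measurable fun ω => ∑' i, P {ω' | x < a * w i ω * Q ω'} +
        (∑' i, P {ω' | x < e * w i ω * Q ω'}) * min 1 (∑' i, P {ω' | x < e * w i ω * Q ω'}) :=
      (hmG a x).add ((hmG e x).mul (measurable_const.min (hmG e x)))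
    rw [lintegral_add_left hmG',
      lintegral_add_left (hmG a x), lintegral_const_mul _ (by fun_prop), ENNReal.add_div,
      ENNReal.add_div]
    congr 1
    simp only [div_eq_mul_inv]
    ring

end RandomWeights

/-! ### Moments of random sums -/

/-- Either `b ≤ t * a` or `a ≤ t⁻¹ * b`. The coefficient of `a ^ p` can be made arbitrarily close to
1, which the usual constant 2^(p - 1) does not allow; the contraction of moments depends on this. -/
theorem ENNReal.add_rpow_le_scaled (a b : ℝ≥0∞) {t : ℝ≥0} (ht : 0 < t) {p : ℝ} (hp : 0 ≤ p) :
    (a + b) ^ p ≤ ((1 + t : ℝ≥0) : ℝ≥0∞) ^ p * a ^ p + ((1 + t⁻¹ : ℝ≥0) : ℝ≥0∞) ^ p * b ^ p := by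
  rw [← ENNReal.mul_rpow_of_nonneg _ _ hp, ← ENNReal.mul_rpow_of_nonneg _ _ hp]
  rcases le_total b (t * a) with h | h
  · refine le_trans (ENNReal.rpow_le_rpow ?_ hp) le_self_add
    push_cast
    rw [add_mul, one_mul]
    gcongr
  · refine le_trans (ENNReal.rpow_le_rpow ?_ hp) le_add_self
    rw [ENNReal.coe_add, ENNReal.coe_one, add_mul, one_mul, add_comm, ENNReal.coe_inv ht.ne']
    gcongr
    rw [← ENNReal.div_eq_inv_mul, ENNReal.le_div_iff_mul_le (Or.inl (by simpa using ht.ne'))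
      (Or.inl ENNReal.coe_ne_top), mul_comm]
    exact h

theorem ENNReal.mul_rpow_sub_one (y : ℝ≥0∞) {γ : ℝ} (hγ : 1 ≤ γ) : y * y ^ (γ - 1) = y ^ γ := by
  conv_rhs => rw [← add_sub_cancel 1 γ, ENNReal.rpow_add_of_nonneg _ _ zero_le_one (by linarith),
    ENNReal.rpow_one]

/-- For γ - 1 ≥ 1 this is the power mean inequality. For γ - 1 ≤ 1, either the sum S is at most n,
or S / n ≥ 1 and (S / n)^(γ - 1) ≤ S / n. After integration by Wald's identity only E N^γ and a
moment of order max(γ - 1, 1) of the summands are needed. -/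
theorem natCast_mul_sum_rpow_le (n : ℕ) (y : ℕ → ℝ≥0∞) {γ : ℝ} (hγ : 1 < γ) :
    (n : ℝ≥0∞) * (∑ i ∈ Finset.range n, y i) ^ (γ - 1) ≤
      (n : ℝ≥0∞) ^ γ + (n : ℝ≥0∞) ^ (γ - 1) * ∑ i ∈ Finset.range n, y i ^ max (γ - 1) 1 := by
  rcases Nat.eq_zero_or_pos n with rfl | hn
  · simp
  have hn0 : (n : ℝ≥0∞) ≠ 0 := by exact_mod_cast hn.ne'
  have hnt : (n : ℝ≥0∞) ≠ ∞ := ENNReal.natCast_ne_top n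
  rcases le_total 1 (γ - 1) with h | h
  · rw [max_eq_left h]
    refine le_trans ?_ le_add_self
    have h1 := ENNReal.rpow_sum_le_const_mul_sum_rpow (Finset.range n) y h
    rw [Finset.card_range] at h1
    calc (n : ℝ≥0∞) * (∑ i ∈ Finset.range n, y i) ^ (γ - 1)
        ≤ n * (n ^ (γ - 1 - 1) * ∑ i ∈ Finset.range n, y i ^ (γ - 1)) := by gcongr
      _ = _ := by rw [← mul_assoc, ENNReal.mul_rpow_sub_one _ h]
  · rw [max_eq_right h]
    simp only [ENNReal.rpow_one]
    set S := ∑ i ∈ Finset.range n, y i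
    rcases le_total S n with hS | hS
    · refine le_trans ?_ le_self_add
      rw [← ENNReal.mul_rpow_sub_one _ hγ.le]
      gcongr
    · refine le_trans ?_ le_add_self
      rcases eq_or_ne S ∞ with htop | htop
      · rw [htop, ENNReal.mul_top (ENNReal.rpow_pos (pos_iff_ne_zero.2 hn0) hnt).ne']
        exact le_top
      have hS0 : S ≠ 0 := fun h0 => hn0 (le_zero_iff.1 (h0 ▸ hS))
      have h1 : (S / n) ^ (γ - 1) ≤ S / n := by
        conv_rhs => rw [← ENNReal.rpow_one (S / n)]
        refine ENNReal.rpow_le_rpow_of_exponent_le ?_ h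
        rw [ENNReal.le_div_iff_mul_le (Or.inl hn0) (Or.inl hnt), one_mul]
        exact hS
      rw [ENNReal.div_rpow_of_nonneg _ _ (by linarith)] at h1
      have hp0 : (n : ℝ≥0∞) ^ (γ - 1) ≠ 0 := (ENNReal.rpow_pos (pos_iff_ne_zero.2 hn0) hnt).ne'
      have hpt : (n : ℝ≥0∞) ^ (γ - 1) ≠ ∞ := ENNReal.rpow_ne_top_of_nonneg (by linarith) hnt
      rw [ENNReal.div_le_iff hp0 hpt] at h1
      calc (n : ℝ≥0∞) * S ^ (γ - 1) ≤ n * (S / n * n ^ (γ - 1)) := by gcongr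
        _ = n ^ (γ - 1) * S := by
          rw [← mul_assoc, ENNReal.mul_div_cancel hn0 hnt, mul_comm]

theorem sum_range_eq_tsum (n : ℕ) (y : ℕ → ℝ≥0∞) :
    ∑ i ∈ Finset.range n, y i = ∑' i, (if i < n then 1 else 0) * y i := by
  rw [tsum_eq_sum (s := Finset.range n)]
  · exact Finset.sum_congr rfl fun i hi => by simp [Finset.mem_range.1 hi]
  · intro i hi
    simp [Finset.mem_range.not.1 hi]

theorem tsum_ite_lt (n : ℕ) : ∑' i, (if i < n then (1 : ℝ≥0∞) else 0) = n := by
  have := sum_range_eq_tsum n fun _ => 1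
  simpa using this.symm

section RandomSum

variable {Ω : Type*} [MeasurableSpace Ω] {P : Measure Ω} {N : Ω → ℕ} {y : ℕ → Ω → ℝ≥0∞}

theorem measurable_indicator_lt (hN : Measurable N) (i : ℕ) :
    Measurable fun ω => if i < N ω then (1 : ℝ≥0∞) else 0 :=
  Measurable.ite (measurableSet_lt measurable_const hN) measurable_const measurable_const

theorem measurable_sum_range (hN : Measurable N) (hy : ∀ i, Measurable (y i)) :
    Measurable fun ω => ∑ i ∈ Finset.range (N ω), y i ω := by
  simp_rw [sum_range_eq_tsum]
  exact Measurable.tsum fun i => (measurable_indicator_lt hN i).mul (hy i)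

theorem tsum_lintegral_mul_indicator (hN : Measurable N) (f : ℕ → ℝ≥0∞) :
    ∑' i, ∫⁻ ω, f (N ω) * (if i < N ω then (1 : ℝ≥0∞) else 0) ∂P = ∫⁻ ω, f (N ω) * N ω ∂P := by
  have hf : Measurable f := measurable_from_top
  have hm : ∀ i, Measurable fun ω => f (N ω) * if i < N ω then (1 : ℝ≥0∞) else 0 := fun i =>
    (hf.comp hN).mul (measurable_indicator_lt hN i)
  rw [← lintegral_tsum fun i => (hm i).aemeasurable]
  simp_rw [ENNReal.tsum_mul_left, tsum_ite_lt]

/-- Wald's identity, with a function of the number of summands as an additional factor. -/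
theorem lintegral_mul_random_sum (hN : Measurable N) (hy : ∀ i, Measurable (y i))
    (hind : ∀ i, IndepFun (y i) N P) (f : ℕ → ℝ≥0∞) :
    ∫⁻ ω, f (N ω) * ∑ i ∈ Finset.range (N ω), y i ω ∂P =
      ∑' i, (∫⁻ ω, f (N ω) * (if i < N ω then (1 : ℝ≥0∞) else 0) ∂P) * ∫⁻ ω, y i ω ∂P := by
  have hf : Measurable f := measurable_from_top
  have hm : ∀ i, Measurable fun ω => f (N ω) * if i < N ω then (1 : ℝ≥0∞) else 0 := fun i =>
    (hf.comp hN).mul (measurable_indicator_lt hN i)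
  have hm' : ∀ i, Measurable fun ω => f (N ω) * ((if i < N ω then (1 : ℝ≥0∞) else 0) * y i ω) :=
    fun i => (hf.comp hN).mul ((measurable_indicator_lt hN i).mul (hy i))
  simp_rw [sum_range_eq_tsum, ← ENNReal.tsum_mul_left]
  rw [lintegral_tsum fun i => (hm' i).aemeasurable]
  refine tsum_congr fun i => ?_
  simp_rw [← mul_assoc]
  exact lintegral_mul_eq_lintegral_mul_lintegral_of_indepFun'' (hm i).aemeasurable
    (hy i).aemeasurable ((hind i).symm.comp
      (φ := fun n => f n * if i < n then (1 : ℝ≥0∞) else 0) measurable_from_top measurable_id)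

theorem lintegral_mul_random_sum_le (hN : Measurable N) (hy : ∀ i, Measurable (y i))
    (hind : ∀ i, IndepFun (y i) N P) {e : ℝ≥0∞} (he : ∀ i, ∫⁻ ω, y i ω ∂P ≤ e) (f : ℕ → ℝ≥0∞) :
    ∫⁻ ω, f (N ω) * ∑ i ∈ Finset.range (N ω), y i ω ∂P ≤ (∫⁻ ω, f (N ω) * N ω ∂P) * e := by
  rw [lintegral_mul_random_sum hN hy hind, ← tsum_lintegral_mul_indicator hN f,
    ← ENNReal.tsum_mul_right]
  gcongr with i
  exact he i

theorem lintegral_random_sum (hN : Measurable N) (hy : ∀ i, Measurable (y i))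
    (hind : ∀ i, IndepFun (y i) N P) {e : ℝ≥0∞} (he : ∀ i, ∫⁻ ω, y i ω ∂P = e) :
    ∫⁻ ω, ∑ i ∈ Finset.range (N ω), y i ω ∂P = (∫⁻ ω, N ω ∂P) * e := by
  have h1 := lintegral_mul_random_sum hN hy hind fun _ => 1
  have h2 := tsum_lintegral_mul_indicator (P := P) hN fun _ => 1
  simp only [one_mul] at h1 h2
  rw [h1, ← h2, ← ENNReal.tsum_mul_right]
  simp_rw [he]

/-- Write S^γ = Σ y_i S^(γ - 1) and split S into y_i and the remaining sum. In the cross terms y_i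
multiplies a quantity free of y_i, so independence will apply. -/
theorem sum_rpow_le_leave_one_out (n : ℕ) (y : ℕ → ℝ≥0∞) {t : ℝ≥0} (ht : 0 < t) {γ : ℝ}
    (hγ : 1 < γ) :
    (∑ i ∈ Finset.range n, y i) ^ γ ≤
      ((1 + t : ℝ≥0) : ℝ≥0∞) ^ (γ - 1) * ∑ i ∈ Finset.range n, y i ^ γ +
      ((1 + t⁻¹ : ℝ≥0) : ℝ≥0∞) ^ (γ - 1) * ∑ i ∈ Finset.range n,
        y i * (∑ j ∈ Finset.range n, Function.update y i 0 j) ^ (γ - 1) := by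
  rw [← ENNReal.mul_rpow_sub_one _ hγ.le, Finset.sum_mul, Finset.mul_sum, Finset.mul_sum,
    ← Finset.sum_add_distrib]
  refine Finset.sum_le_sum fun i hi => ?_
  have hS : ∑ j ∈ Finset.range n, y j =
      y i + ∑ j ∈ Finset.range n, Function.update y i 0 j := by
    rw [Finset.sum_update_of_mem hi, zero_add, Finset.sdiff_singleton_eq_erase,
      Finset.add_sum_erase _ _ hi]
  rw [hS, ← ENNReal.mul_rpow_sub_one (y i) hγ.le]
  refine (mul_le_mul' le_rfl (ENNReal.add_rpow_le_scaled _ _ ht (by linarith))).trans_eq ?_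
  ring

/-- The diagonal part has coefficient close to 1 and mean at most E[N] a. In the cross part the mean
of y_i factors out; afterwards y_i may be put back into the sum, and summing over i < N leaves N
S^(γ - 1). -/
theorem lintegral_random_sum_rpow_le (hN : Measurable N) (hy : ∀ i, Measurable (y i))
    (hind : ∀ i, IndepFun (y i) (fun ω => (N ω, Function.update (fun j => y j ω) i 0)) P)
    {γ : ℝ} (hγ : 1 < γ) {t : ℝ≥0} (ht : 0 < t) {a b₁ b₂ : ℝ≥0∞}
    (ha : ∀ i, ∫⁻ ω, y i ω ^ γ ∂P ≤ a) (hb₁ : ∀ i, ∫⁻ ω, y i ω ∂P ≤ b₁)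
    (hb₂ : ∀ i, ∫⁻ ω, y i ω ^ max (γ - 1) 1 ∂P ≤ b₂) :
    ∫⁻ ω, (∑ i ∈ Finset.range (N ω), y i ω) ^ γ ∂P ≤
      ((1 + t : ℝ≥0) : ℝ≥0∞) ^ (γ - 1) * ((∫⁻ ω, N ω ∂P) * a) +
      ((1 + t⁻¹ : ℝ≥0) : ℝ≥0∞) ^ (γ - 1) * (b₁ * ((∫⁻ ω, (N ω : ℝ≥0∞) ^ γ ∂P) * (1 + b₂))) := by
  have hindN : ∀ i, IndepFun (y i) N P := fun i => (hind i).comp measurable_id measurable_fst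
  set R : ℕ → Ω → ℝ≥0∞ := fun i ω =>
    (∑ j ∈ Finset.range (N ω), Function.update (fun j => y j ω) i 0 j) ^ (γ - 1)
  have hupd : ∀ i, Measurable fun ω => (N ω, Function.update (fun j => y j ω) i 0) := by
    refine fun i => hN.prodMk (measurable_pi_lambda _ fun j => ?_)
    rcases eq_or_ne j i with rfl | hj
    · simp
    · simpa [Function.update_of_ne hj] using hy j
  have hΨ : ∀ i, Measurable fun p : ℕ × (ℕ → ℝ≥0∞) => (if i < p.1 then (1 : ℝ≥0∞) else 0) *
      (∑ j ∈ Finset.range p.1, p.2 j) ^ (γ - 1) := fun i =>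
    (measurable_indicator_lt measurable_fst i).mul
      ((measurable_sum_range measurable_fst fun j => by fun_prop).pow_const _)
  have hR : ∀ i, Measurable fun ω => (if i < N ω then (1 : ℝ≥0∞) else 0) * R i ω := fun i =>
    (hΨ i).comp (hupd i)
  have hfirst : ∫⁻ ω, ∑ i ∈ Finset.range (N ω), y i ω ^ γ ∂P ≤ (∫⁻ ω, N ω ∂P) * a := by
    have := lintegral_mul_random_sum_le hN (fun i => (hy i).pow_const γ)
      (fun i => (hindN i).comp (measurable_id.pow_const γ) measurable_id) ha fun _ => 1
    simpa using this
  have hlast : ∫⁻ ω, (N ω : ℝ≥0∞) ^ (γ - 1) *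
      ∑ i ∈ Finset.range (N ω), y i ω ^ max (γ - 1) 1 ∂P ≤
      (∫⁻ ω, (N ω : ℝ≥0∞) ^ γ ∂P) * b₂ := by
    have := lintegral_mul_random_sum_le hN (fun i => (hy i).pow_const (max (γ - 1) 1))
      (fun i => (hindN i).comp (measurable_id.pow_const _) measurable_id) hb₂
      fun n => (n : ℝ≥0∞) ^ (γ - 1)
    refine this.trans_eq ?_
    congr 1
    refine lintegral_congr fun ω => ?_
    rw [mul_comm, ENNReal.mul_rpow_sub_one _ hγ.le]
  have hNm : Measurable fun ω => (N ω : ℝ≥0∞) ^ γ :=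
    (measurable_from_top (f := fun n : ℕ => (n : ℝ≥0∞) ^ γ)).comp hN
  have hcross : ∫⁻ ω, ∑ i ∈ Finset.range (N ω), y i ω * R i ω ∂P ≤
      b₁ * ((∫⁻ ω, (N ω : ℝ≥0∞) ^ γ ∂P) * (1 + b₂)) := by
    have hyR : ∀ i, Measurable fun ω => y i ω * ((if i < N ω then (1 : ℝ≥0∞) else 0) * R i ω) :=
      fun i => (hy i).mul (hR i)
    simp_rw [sum_range_eq_tsum, mul_left_comm _ (y _ _)]
    rw [lintegral_tsum fun i => (hyR i).aemeasurable]
    have h1 : ∀ i, ∫⁻ ω, y i ω * ((if i < N ω then (1 : ℝ≥0∞) else 0) * R i ω) ∂P ≤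
        b₁ * ∫⁻ ω, (if i < N ω then (1 : ℝ≥0∞) else 0) * R i ω ∂P := by
      intro i
      rw [lintegral_mul_eq_lintegral_mul_lintegral_of_indepFun'' (hy i).aemeasurable
        (hR i).aemeasurable ((hind i).comp measurable_id (hΨ i))]
      gcongr
      exact hb₁ i
    refine (ENNReal.tsum_le_tsum h1).trans ?_
    rw [ENNReal.tsum_mul_left, ← lintegral_tsum fun i => (hR i).aemeasurable, mul_add, mul_one]
    gcongr
    refine le_trans ?_ (add_le_add_right hlast _)
    rw [← lintegral_add_left hNm]
    refine lintegral_mono fun ω => ?_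
    refine le_trans ?_ (natCast_mul_sum_rpow_le (N ω) (fun i => y i ω) hγ)
    rw [← tsum_ite_lt, ← ENNReal.tsum_mul_right]
    gcongr with i
    refine ENNReal.rpow_le_rpow (Finset.sum_le_sum fun j _ => ?_) (by linarith)
    rcases eq_or_ne j i with rfl | hj
    · simp
    · rw [Function.update_of_ne hj]
  have hfm : Measurable fun ω => ∑ i ∈ Finset.range (N ω), y i ω ^ γ :=
    measurable_sum_range hN fun i => (hy i).pow_const γ
  have hcm : Measurable fun ω => ∑ i ∈ Finset.range (N ω), y i ω * R i ω := by
    simp_rw [sum_range_eq_tsum, mul_left_comm _ (y _ _)]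
    exact Measurable.tsum fun i => (hy i).mul (hR i)
  refine (lintegral_mono fun ω => sum_rpow_le_leave_one_out (N ω) (fun i => y i ω) ht hγ).trans ?_
  rw [lintegral_add_left (hfm.const_mul _), lintegral_const_mul _ hfm, lintegral_const_mul _ hcm]
  gcongr

end RandomSum

/-! ### Generations of the tree -/

/-- The total weight of the `n`-th generation, without innovations, computed from the root. -/
noncomputable def levelSum : ℕ → (List ℕ → ℕ) → (List ℕ → ℝ≥0) → ℝ≥0∞
  | 0, _, _ => 1
  | n + 1, N, C => ∑ i ∈ Finset.range (N []),
      C [i] * levelSum n (fun v => N (i :: v)) (fun v => C (i :: v))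

theorem length_of_mem_generation {N : List ℕ → ℕ} {n : ℕ} {v : List ℕ}
    (hv : v ∈ generation N n) : v.length = n := by
  induction n generalizing v with
  | zero => simp_all [generation]
  | succ n ih =>
    simp only [generation, Finset.mem_biUnion, Finset.mem_image] at hv
    obtain ⟨u, hu, i, -, rfl⟩ := hv
    simp [ih hu]

/-- The definition grows the tree at its leaves; the recursions need the decomposition at the root
into subtrees. -/
theorem generation_succ (N : List ℕ → ℕ) (n : ℕ) :
    generation N (n + 1) = (Finset.range (N [])).biUnion fun i =>
      (generation (fun v => N (i :: v)) n).image fun u => i :: u := by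
  induction n with
  | zero =>
    ext v
    simp [generation, eq_comm]
  | succ n ih =>
    ext v
    rw [generation, ih]
    simp only [generation, Finset.mem_biUnion, Finset.mem_image, Finset.mem_range]
    constructor
    · rintro ⟨_, ⟨i, hi, u, hu, rfl⟩, j, hj, rfl⟩
      exact ⟨i, hi, u ++ [j], ⟨u, hu, j, hj, rfl⟩, rfl⟩
    · rintro ⟨i, hi, _, ⟨u, hu, j, hj, rfl⟩, rfl⟩
      exact ⟨i :: u, ⟨i, hi, u, hu, rfl⟩, j, hj, rfl⟩

theorem branchWeight_cons (C : List ℕ → ℝ≥0) (i : ℕ) (u : List ℕ) :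
    branchWeight C (i :: u) = C [i] * branchWeight (fun v => C (i :: v)) u := by
  simp [branchWeight, Finset.prod_range_succ', mul_comm]

theorem sum_branchWeight_eq_levelSum (N : List ℕ → ℕ) (C : List ℕ → ℝ≥0) (n : ℕ) :
    ∑ v ∈ generation N n, (branchWeight C v : ℝ≥0∞) = levelSum n N C := by
  induction n generalizing N C with
  | zero => simp [generation, levelSum, branchWeight]
  | succ n ih =>
    rw [generation_succ, levelSum, Finset.sum_biUnion]
    · refine Finset.sum_congr rfl fun i _ => ?_
      rw [Finset.sum_image fun u _ v _ h => (List.cons_injective h), ← ih, Finset.mul_sum]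
      simp_rw [branchWeight_cons, ENNReal.coe_mul]
    · intro i _ j _ hij
      refine Finset.disjoint_left.2 fun v hi hj => hij ?_
      obtain ⟨u, -, rfl⟩ := Finset.mem_image.1 hi
      obtain ⟨u', -, h⟩ := Finset.mem_image.1 hj
      exact (List.cons.inj h).1.symm

theorem branchWeight_rpow (C : List ℕ → ℝ≥0) (v : List ℕ) (γ : ℝ) :
    branchWeight (fun u => C u ^ γ) v = branchWeight C v ^ γ := by
  simp [branchWeight, NNReal.finsetProd_rpow]

/-- The weight of `v` if it is an individual of the tree, otherwise `0`. -/
noncomputable def nodeWeight (N : List ℕ → ℕ) (C : List ℕ → ℝ≥0) (v : List ℕ) : ℝ≥0 :=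
  if v ∈ generation N v.length then branchWeight C v else 0

theorem tsum_generation (N : List ℕ → ℕ) (f g : List ℕ → ℝ≥0∞)
    (hf : ∀ v, f v = if v ∈ generation N v.length then g v else 0) :
    ∑' v, f v = ∑' n, ∑ v ∈ generation N n, g v := by
  have h1 : ∀ v, f v = ∑' n, if v ∈ generation N n then g v else 0 := by
    intro v
    rw [hf, tsum_eq_single v.length]
    intro n hn
    rw [if_neg fun h => hn (length_of_mem_generation h).symm]
  simp_rw [h1]
  rw [ENNReal.tsum_comm]
  refine tsum_congr fun n => ?_
  rw [tsum_eq_sum (s := generation N n) fun v hv => if_neg hv]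
  exact Finset.sum_congr rfl fun v hv => if_pos hv

theorem totalWeight_eq_tsum (N : List ℕ → ℕ) (Q C : List ℕ → ℝ≥0) :
    totalWeight N Q C = ∑' v, (nodeWeight N C v * Q v : ℝ≥0∞) := by
  rw [tsum_generation N _ (fun v => ((Q v * branchWeight C v : ℝ≥0) : ℝ≥0∞))]
  · simp [totalWeight, generationWeight]
  · intro v
    rw [nodeWeight]
    split_ifs <;> simp [mul_comm]

/-- Powers pass through products, so the γ-th powers of the weights are the weights of the tree with
factors C^γ. -/
theorem tsum_nodeWeight_rpow (N : List ℕ → ℕ) (C : List ℕ → ℝ≥0) {γ : ℝ} (hγ : 0 < γ) :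
    ∑' v, (nodeWeight N C v : ℝ≥0∞) ^ γ = ∑' n, levelSum n N fun u => C u ^ γ := by
  rw [tsum_generation N _ (fun v => ((branchWeight C v ^ γ : ℝ≥0) : ℝ≥0∞))]
  · refine tsum_congr fun n => ?_
    rw [← sum_branchWeight_eq_levelSum]
    simp_rw [branchWeight_rpow]
  · intro v
    rw [nodeWeight]
    split_ifs
    · rw [ENNReal.coe_rpow_of_nonneg _ hγ.le]
    · simp [hγ]

theorem tsum_nodeWeight (N : List ℕ → ℕ) (C : List ℕ → ℝ≥0) :
    ∑' v, (nodeWeight N C v : ℝ≥0∞) = ∑' n, levelSum n N C := by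
  simpa using tsum_nodeWeight_rpow N C one_pos

/-! ### Moments of the weights of the tree -/

/-- Independent families of i.i.d. copies of `N` and of `C`, indexed by the finite sequences. -/
structure IsTreeFamily {Ω : Type*} [MeasurableSpace Ω] (P : Measure Ω) (N : Ω → ℕ) (C : Ω → ℝ≥0)
    (Nt : List ℕ → Ω → ℕ) (Ct : List ℕ → Ω → ℝ≥0) : Prop where
  measurable_N : ∀ v, Measurable (Nt v)
  measurable_C : ∀ v, Measurable (Ct v)
  ident_N : ∀ v, IdentDistrib (Nt v) N P P
  ident_C : ∀ v, IdentDistrib (Ct v) C P P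
  indep : iIndepFun (Sum.elim (fun v ω => (Nt v ω : ℝ≥0)) Ct : List ℕ ⊕ List ℕ → Ω → ℝ≥0) P

/-- The `σ`-algebra generated by the variables with indices in `S`. -/
@[reducible]
def indexedSigma {Ω κ : Type*} (X : κ → Ω → ℝ≥0) (S : Set κ) : MeasurableSpace Ω :=
  ⨆ k ∈ S, MeasurableSpace.comap (X k) inferInstance

/-! ### Independence from disjoint sets of indices -/

section indexedSigma

variable {Ω κ : Type*} {X : κ → Ω → ℝ≥0} {S T : Set κ}

theorem measurable_indexedSigma {k : κ} (hk : k ∈ S) : Measurable[indexedSigma X S] (X k) :=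
  measurable_iff_comap_le.2 (le_iSup₂_of_le k hk le_rfl)

theorem indepFun_of_indexedSigma [mΩ : MeasurableSpace Ω] {P : Measure Ω}
    (hX : ∀ k, Measurable (X k)) (hi : iIndepFun X P) (hST : Disjoint S T)
    {β γ : Type*} [MeasurableSpace β] [MeasurableSpace γ] {f : Ω → β} {g : Ω → γ}
    (hf : Measurable[indexedSigma X S] f) (hg : Measurable[indexedSigma X T] g) :
    IndepFun f g P := by
  have h := indep_iSup_of_disjoint (fun k => (hX k).comap_le) hi.iIndep hST
  rw [IndepFun_iff_Indep]
  exact indep_of_indep_of_le_left (indep_of_indep_of_le_right h hg.comap_le) hf.comap_le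

end indexedSigma

section

variable {Ω : Type*} {Nt : List ℕ → Ω → ℕ} {Ct : List ℕ → Ω → ℝ≥0}

theorem measurable_N_indexedSigma {S : Set (List ℕ ⊕ List ℕ)} {v : List ℕ} (hv : Sum.inl v ∈ S) :
    Measurable[indexedSigma (Sum.elim (fun v ω => (Nt v ω : ℝ≥0)) Ct) S] (Nt v) := by
  have h1 := measurable_indexedSigma (X := (Sum.elim (fun v ω => (Nt v ω : ℝ≥0)) Ct)) hv
  have h2 := Nat.measurable_floor.comp h1
  convert h2 using 1
  funext ω
  simp

theorem measurable_C_indexedSigma {S : Set (List ℕ ⊕ List ℕ)} {v : List ℕ} (hv : Sum.inr v ∈ S) :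
    Measurable[indexedSigma (Sum.elim (fun v ω => (Nt v ω : ℝ≥0)) Ct) S] (Ct v) :=
  measurable_indexedSigma (X := (Sum.elim (fun v ω => (Nt v ω : ℝ≥0)) Ct)) hv

end

theorem measurable_levelSum {Ω : Type*} [MeasurableSpace Ω] (n : ℕ) {Nt : List ℕ → Ω → ℕ}
    {Ct : List ℕ → Ω → ℝ≥0} (hN : ∀ v, Measurable (Nt v))
    (hC : ∀ v, v ≠ [] → Measurable (Ct v)) :
    Measurable fun ω => levelSum n (fun v => Nt v ω) (fun v => Ct v ω) := by
  induction n generalizing Nt Ct with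
  | zero => exact measurable_const
  | succ n ih =>
    simp only [levelSum]
    exact measurable_sum_range (hN []) fun i => (hC [i] (by simp)).coe_nnreal_ennreal.mul
      (ih (fun v => hN _) fun v _ => hC _ (by simp))

/-- The total weight of the generations up to the `n`-th. -/
noncomputable def partialWeight (n : ℕ) (N : List ℕ → ℕ) (C : List ℕ → ℝ≥0) : ℝ≥0∞ :=
  ∑ k ∈ Finset.range (n + 1), levelSum k N C

theorem partialWeight_succ (n : ℕ) (N : List ℕ → ℕ) (C : List ℕ → ℝ≥0) :
    partialWeight (n + 1) N C = ∑ i ∈ Finset.range (N []),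
      C [i] * partialWeight n (fun v => N (i :: v)) (fun v => C (i :: v)) + 1 := by
  rw [partialWeight, Finset.sum_range_succ']
  simp only [levelSum]
  rw [Finset.sum_comm]
  simp_rw [← Finset.mul_sum]
  rfl

theorem measurable_partialWeight {Ω : Type*} [MeasurableSpace Ω] (n : ℕ) {Nt : List ℕ → Ω → ℕ}
    {Ct : List ℕ → Ω → ℝ≥0} (hN : ∀ v, Measurable (Nt v))
    (hC : ∀ v, v ≠ [] → Measurable (Ct v)) :
    Measurable fun ω => partialWeight n (fun v => Nt v ω) (fun v => Ct v ω) :=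
  Finset.measurable_fun_sum _ fun k _ => measurable_levelSum k hN hC

section

variable {Ω : Type*} {Nt : List ℕ → Ω → ℕ} {Ct : List ℕ → Ω → ℝ≥0}
  {F : (List ℕ → ℕ) → (List ℕ → ℝ≥0) → ℝ≥0∞}

/-- `F` is a measurable function of the offspring numbers and of the factors of all individuals
other than the root. -/
def MeasurableOffRoot (Ω : Type*) (F : (List ℕ → ℕ) → (List ℕ → ℝ≥0) → ℝ≥0∞) : Prop :=
  ∀ (_ : MeasurableSpace Ω) (Nt : List ℕ → Ω → ℕ) (Ct : List ℕ → Ω → ℝ≥0),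
    (∀ v, Measurable (Nt v)) → (∀ v, v ≠ [] → Measurable (Ct v)) →
    Measurable fun ω => F (fun v => Nt v ω) (fun v => Ct v ω)

/-- The weight of the first-generation individual `i` together with its descendants. -/
noncomputable def childTerm (F : (List ℕ → ℕ) → (List ℕ → ℝ≥0) → ℝ≥0∞)
    (Nt : List ℕ → Ω → ℕ) (Ct : List ℕ → Ω → ℝ≥0) (i : ℕ) (ω : Ω) : ℝ≥0∞ :=
  Ct [i] ω * F (fun v => Nt (i :: v) ω) (fun v => Ct (i :: v) ω)

/-- The indices below the first-generation individual `i`. -/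
def below (i : ℕ) : Set (List ℕ ⊕ List ℕ) :=
  {k | k.elim (fun v => ∃ u, v = i :: u) fun v => ∃ u, v = i :: u}

/-- `MeasurableOffRoot` quantifies over all σ-algebras on `Ω` so that it can be applied to the one
generated by `S`. -/
theorem measurable_childTerm_indexedSigma (hF : MeasurableOffRoot Ω F) {i : ℕ}
    {S : Set (List ℕ ⊕ List ℕ)} (hS : below i ⊆ S) :
    Measurable[indexedSigma (Sum.elim (fun v ω => (Nt v ω : ℝ≥0)) Ct) S] (childTerm F Nt Ct i) := by
  let _ := indexedSigma (Sum.elim (fun v ω => (Nt v ω : ℝ≥0)) Ct) S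
  refine (measurable_C_indexedSigma (hS ⟨[], rfl⟩)).coe_nnreal_ennreal.mul (hF _ _ _ ?_ ?_)
  · exact fun v => measurable_N_indexedSigma (hS ⟨v, rfl⟩)
  · exact fun v _ => measurable_C_indexedSigma (hS ⟨v, rfl⟩)

theorem measurableOffRoot_levelSum (n : ℕ) : MeasurableOffRoot Ω (levelSum n) :=
  fun _ _ _ hN hC => measurable_levelSum n hN hC

theorem measurableOffRoot_partialWeight (n : ℕ) : MeasurableOffRoot Ω (partialWeight n) :=
  fun _ _ _ hN hC => measurable_partialWeight n hN hC

end

/-! ### Independence across subtrees and first moments -/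

namespace IsTreeFamily

variable {Ω : Type*} [MeasurableSpace Ω] {P : Measure Ω} {N : Ω → ℕ} {C : Ω → ℝ≥0}
  {Nt : List ℕ → Ω → ℕ} {Ct : List ℕ → Ω → ℝ≥0}

theorem subtree (h : IsTreeFamily P N C Nt Ct) (i : ℕ) :
    IsTreeFamily P N C (fun v => Nt (i :: v)) (fun v => Ct (i :: v)) where
  measurable_N _ := h.measurable_N _
  measurable_C _ := h.measurable_C _
  ident_N _ := h.ident_N _
  ident_C _ := h.ident_C _
  indep := by
    have hinj : Function.Injective (Sum.map (List.cons i) (List.cons i)) :=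
      Sum.map_injective.2 ⟨List.cons_injective, List.cons_injective⟩
    convert h.indep.precomp hinj using 1
    funext k
    rcases k with k | k <;> rfl

theorem rpow (h : IsTreeFamily P N C Nt Ct) (γ : ℝ) :
    IsTreeFamily P N (fun ω => C ω ^ γ) Nt (fun v ω => Ct v ω ^ γ) where
  measurable_N := h.measurable_N
  measurable_C v := (h.measurable_C v).pow_const γ
  ident_N := h.ident_N
  ident_C v := (h.ident_C v).comp (measurable_id.pow_const γ)
  indep := by
    have := h.indep.comp (fun k => k.elim (fun _ => id) fun _ y => y ^ γ) (by
      rintro (k | k)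
      · exact measurable_id
      · exact measurable_id.pow_const γ)
    convert this using 1
    funext k
    rcases k with k | k <;> rfl

theorem measurable_elim (h : IsTreeFamily P N C Nt Ct) (k : List ℕ ⊕ List ℕ) :
    Measurable ((Sum.elim (fun v ω => (Nt v ω : ℝ≥0)) Ct : List ℕ ⊕ List ℕ → Ω → ℝ≥0) k) := by
  rcases k with k | k
  · exact (measurable_from_top (f := fun n : ℕ => (n : ℝ≥0))).comp (h.measurable_N k)
  · exact h.measurable_C k

variable {F : (List ℕ → ℕ) → (List ℕ → ℝ≥0) → ℝ≥0∞}

theorem measurable_childTerm (h : IsTreeFamily P N C Nt Ct) (hF : MeasurableOffRoot Ω F) (i : ℕ) :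
    Measurable (childTerm F Nt Ct i) :=
  (h.measurable_C _).coe_nnreal_ennreal.mul
    (hF _ _ _ (fun _ => h.measurable_N _) fun _ _ => h.measurable_C _)

/-- The term of child `i` uses only indices below `i`; the offspring number of the root and the
terms of the other children use only the complement. -/
theorem indepFun_childTerm (h : IsTreeFamily P N C Nt Ct) (hF : MeasurableOffRoot Ω F) (i : ℕ) :
    IndepFun (childTerm F Nt Ct i)
      (fun ω => (Nt [] ω, Function.update (fun j => childTerm F Nt Ct j ω) i 0)) P := by
  refine indepFun_of_indexedSigma h.measurable_elim h.indep (S := below i) (T := (below i)ᶜ)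
    disjoint_compl_right (measurable_childTerm_indexedSigma hF subset_rfl) ?_
  let _ := indexedSigma (Sum.elim (fun v ω => (Nt v ω : ℝ≥0)) Ct) (below i)ᶜ
  refine Measurable.prodMk (measurable_N_indexedSigma (by simp [below])) ?_
  refine measurable_pi_lambda _ fun j => ?_
  rcases eq_or_ne j i with rfl | hj
  · simp
  · simp only [Function.update_of_ne hj]
    refine measurable_childTerm_indexedSigma hF ?_
    rintro (k | k) ⟨u, rfl⟩ ⟨u', hu'⟩ <;> exact hj (List.cons.inj hu').1

theorem lintegral_childTerm_rpow (h : IsTreeFamily P N C Nt Ct) (hF : MeasurableOffRoot Ω F)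
    (i : ℕ) {γ : ℝ} (hγ : 0 ≤ γ) :
    ∫⁻ ω, childTerm F Nt Ct i ω ^ γ ∂P = (∫⁻ ω, (C ω : ℝ≥0∞) ^ γ ∂P) *
      ∫⁻ ω, F (fun v => Nt (i :: v) ω) (fun v => Ct (i :: v) ω) ^ γ ∂P := by
  have hind : IndepFun (Ct [i])
      (fun ω => F (fun v => Nt (i :: v) ω) (fun v => Ct (i :: v) ω)) P := by
    refine indepFun_of_indexedSigma h.measurable_elim h.indep (S := {Sum.inr [i]})
      (T := {Sum.inr [i]}ᶜ) disjoint_compl_right (measurable_C_indexedSigma rfl) ?_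
    let _ := indexedSigma (Sum.elim (fun v ω => (Nt v ω : ℝ≥0)) Ct) {Sum.inr [i]}ᶜ
    -- The factor at the root of the subtree is `Ct [i]` itself; `F` must ignore it for the
    -- independence to hold.
    refine hF _ _ _ (fun v => measurable_N_indexedSigma (by simp)) fun v hv => ?_
    exact measurable_C_indexedSigma (by simpa using hv)
  have hm : Measurable fun y : ℝ≥0 => (y : ℝ≥0∞) ^ γ := by fun_prop
  have hFm : Measurable fun ω => F (fun v => Nt (i :: v) ω) (fun v => Ct (i :: v) ω) :=
    hF _ _ _ (fun _ => h.measurable_N _) fun _ _ => h.measurable_C _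
  simp only [childTerm, ENNReal.mul_rpow_of_nonneg _ _ hγ]
  have hCm : Measurable fun ω => (Ct [i] ω : ℝ≥0∞) ^ γ := hm.comp (h.measurable_C _)
  rw [lintegral_mul_eq_lintegral_mul_lintegral_of_indepFun'' hCm.aemeasurable
    (hFm.pow_const γ).aemeasurable (hind.comp hm (measurable_id.pow_const γ))]
  congr 1
  exact ((h.ident_C _).comp hm).lintegral_eq

theorem lintegral_N_rpow (h : IsTreeFamily P N C Nt Ct) (v : List ℕ) (γ : ℝ) :
    ∫⁻ ω, (Nt v ω : ℝ≥0∞) ^ γ ∂P = ∫⁻ ω, (N ω : ℝ≥0∞) ^ γ ∂P :=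
  ((h.ident_N v).comp (measurable_from_top (f := fun n : ℕ => (n : ℝ≥0∞) ^ γ))).lintegral_eq

/-- Wald's identity at the root multiplies the mean by E[N] E[C] in each generation. -/
theorem lintegral_levelSum [IsProbabilityMeasure P] (h : IsTreeFamily P N C Nt Ct) (n : ℕ) :
    ∫⁻ ω, levelSum n (fun v => Nt v ω) (fun v => Ct v ω) ∂P =
      ((∫⁻ ω, N ω ∂P) * ∫⁻ ω, C ω ∂P) ^ n := by
  induction n generalizing Nt Ct with
  | zero => simp [levelSum]
  | succ n ih =>
    have hF := measurableOffRoot_levelSum (Ω := Ω) n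
    have he : ∀ i, ∫⁻ ω, childTerm (levelSum n) Nt Ct i ω ∂P =
        (∫⁻ ω, C ω ∂P) * ((∫⁻ ω, N ω ∂P) * ∫⁻ ω, C ω ∂P) ^ n := by
      intro i
      have := h.lintegral_childTerm_rpow hF i zero_le_one
      simp only [ENNReal.rpow_one] at this
      rw [this, ih (h.subtree i)]
    have h1 := lintegral_random_sum (h.measurable_N []) (h.measurable_childTerm hF)
      (fun i => (h.indepFun_childTerm hF i).comp measurable_id measurable_fst) he
    have h2 := h.lintegral_N_rpow [] 1
    simp only [ENNReal.rpow_one] at h2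
    rw [h2] at h1
    refine h1.trans ?_
    ring

end IsTreeFamily

/-- The moments of order `γ` of the partial weights are bounded, uniformly in the tree. -/
def BoundedMoments {Ω : Type*} [MeasurableSpace Ω] (P : Measure Ω) (N : Ω → ℕ) (C : Ω → ℝ≥0)
    (γ : ℝ) : Prop :=
  ∃ K : ℝ≥0, ∀ n Nt Ct, IsTreeFamily P N C Nt Ct →
    ∫⁻ ω, partialWeight n (fun v => Nt v ω) (fun v => Ct v ω) ^ γ ∂P ≤ K

/-! ### Convexity of moments in the exponent -/

section Interpolation

variable {Ω : Type*} [MeasurableSpace Ω] {P : Measure Ω} {C : Ω → ℝ≥0}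

/-- Weighted AM-GM applied pointwise; the value `C ω = 0` needs a positive exponent and is treated
apart. -/
theorem lintegral_rpow_le_interpolate (hC : Measurable C) {γ₀ γ₁ : ℝ} (h0 : 0 < γ₀)
    (h1 : 0 < γ₁) {s t : ℝ≥0} (hst : s + t = 1) :
    ∫⁻ ω, (C ω : ℝ≥0∞) ^ (s * γ₀ + t * γ₁) ∂P ≤
      s * ∫⁻ ω, (C ω : ℝ≥0∞) ^ γ₀ ∂P + t * ∫⁻ ω, (C ω : ℝ≥0∞) ^ γ₁ ∂P := by
  rw [← lintegral_const_mul _ (by fun_prop), ← lintegral_const_mul _ (by fun_prop),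
    ← lintegral_add_left (by fun_prop)]
  refine lintegral_mono fun ω => ?_
  have hpos : 0 < s * γ₀ + t * γ₁ := by
    have hst' : (s : ℝ) + t = 1 := by exact_mod_cast hst
    rcases eq_or_lt_of_le s.2 with hs | hs
    · have hs : (s : ℝ) = 0 := hs.symm
      rw [hs, zero_add] at hst'
      rw [hs, hst']
      linarith
    · have := mul_pos hs h0
      have := mul_nonneg t.2 h1.le
      have hs' : (0 : ℝ) < s := hs
      positivity
  rcases eq_or_ne (C ω) 0 with h | h
  · simp [h, hpos]
  · rw [← ENNReal.coe_rpow_of_ne_zero h, ← ENNReal.coe_rpow_of_ne_zero h,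
      ← ENNReal.coe_rpow_of_ne_zero h]
    have := NNReal.geom_mean_le_arith_mean2_weighted s t (C ω ^ γ₀) (C ω ^ γ₁) hst
    rw [← NNReal.rpow_mul, ← NNReal.rpow_mul, ← NNReal.rpow_add h, mul_comm γ₀,
      mul_comm γ₁] at this
    rw [← ENNReal.coe_mul, ← ENNReal.coe_mul, ← ENNReal.coe_add]
    exact ENNReal.coe_le_coe.2 this

theorem exists_interpolate {γ₀ γ₁ γ : ℝ} (h0 : γ₀ ≤ γ) (h1 : γ ≤ γ₁) :
    ∃ s t : ℝ≥0, s + t = 1 ∧ s * γ₀ + t * γ₁ = γ := by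
  have hmem : γ ∈ segment ℝ γ₀ γ₁ := by
    rw [segment_eq_Icc (h0.trans h1)]
    exact ⟨h0, h1⟩
  obtain ⟨s, t, hs, ht, hst, h⟩ := hmem
  exact ⟨⟨s, hs⟩, ⟨t, ht⟩, NNReal.eq hst, h⟩

theorem mul_lintegral_rpow_lt_one (hC : Measurable C) {e : ℝ≥0∞} {γ₀ γ₁ γ : ℝ} (hpos : 0 < γ₀)
    (h0 : γ₀ ≤ γ) (h1 : γ ≤ γ₁) (hρ₀ : e * ∫⁻ ω, (C ω : ℝ≥0∞) ^ γ₀ ∂P < 1)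
    (hρ₁ : e * ∫⁻ ω, (C ω : ℝ≥0∞) ^ γ₁ ∂P < 1) : e * ∫⁻ ω, (C ω : ℝ≥0∞) ^ γ ∂P < 1 := by
  obtain ⟨s, t, hst, rfl⟩ := exists_interpolate h0 h1
  set m := max (e * ∫⁻ ω, (C ω : ℝ≥0∞) ^ γ₀ ∂P) (e * ∫⁻ ω, (C ω : ℝ≥0∞) ^ γ₁ ∂P)
  calc e * ∫⁻ ω, (C ω : ℝ≥0∞) ^ (s * γ₀ + t * γ₁) ∂P
      ≤ e * (s * ∫⁻ ω, (C ω : ℝ≥0∞) ^ γ₀ ∂P + t * ∫⁻ ω, (C ω : ℝ≥0∞) ^ γ₁ ∂P) := by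
        gcongr
        exact lintegral_rpow_le_interpolate hC hpos (hpos.trans_le (h0.trans h1)) hst
    _ = s * (e * ∫⁻ ω, (C ω : ℝ≥0∞) ^ γ₀ ∂P) + t * (e * ∫⁻ ω, (C ω : ℝ≥0∞) ^ γ₁ ∂P) := by ring
    _ ≤ s * m + t * m := by
        gcongr
        · exact le_max_left _ _
        · exact le_max_right _ _
    _ = m := by
        rw [← add_mul, ← ENNReal.coe_add, hst, ENNReal.coe_one, one_mul]
    _ < 1 := max_lt hρ₀ hρ₁

/-- Subcriticality at `γ₀` extends to some larger exponents. -/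
theorem exists_mul_lintegral_rpow_lt_one (hC : Measurable C) {e : ℝ≥0∞} {γ₀ γ₁ : ℝ}
    (hpos : 0 < γ₀) (h01 : γ₀ < γ₁) (hρ₀ : e * ∫⁻ ω, (C ω : ℝ≥0∞) ^ γ₀ ∂P < 1)
    (hρ₁ : e * ∫⁻ ω, (C ω : ℝ≥0∞) ^ γ₁ ∂P ≠ ∞) :
    ∃ γ, γ₀ < γ ∧ γ ≤ γ₁ ∧ e * ∫⁻ ω, (C ω : ℝ≥0∞) ^ γ ∂P < 1 := by
  set a := e * ∫⁻ ω, (C ω : ℝ≥0∞) ^ γ₀ ∂P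
  set b := e * ∫⁻ ω, (C ω : ℝ≥0∞) ^ γ₁ ∂P
  -- Convexity bounds the value at the exponent (1 - t) γ₀ + t γ₁ by a + t b, which is below 1 for
  -- small t because b is finite.
  have hlim : Tendsto (fun t : ℝ≥0 => a + (t : ℝ≥0∞) * b) (𝓝[>] 0) (𝓝 a) := by
    have h1 : Tendsto (fun t : ℝ≥0 => (t : ℝ≥0∞)) (𝓝 0) (𝓝 0) := by
      simpa using ENNReal.continuous_coe.tendsto (0 : ℝ≥0)
    have h2 := tendsto_const_nhds (x := a) |>.add (ENNReal.Tendsto.mul_const h1 (Or.inr hρ₁))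
    rw [zero_mul, add_zero] at h2
    exact h2.mono_left nhdsWithin_le_nhds
  have hsmall : ∀ᶠ t : ℝ≥0 in 𝓝[>] 0, t < 1 :=
    nhdsWithin_le_nhds (gt_mem_nhds one_pos)
  obtain ⟨t, ⟨ht, ht1⟩, ht0⟩ :=
    (((hlim.eventually_lt_const hρ₀).and hsmall).and self_mem_nhdsWithin).exists
  have ht0 : (0 : ℝ) < t := ht0
  have ht1' : (t : ℝ) ≤ 1 := ht1.le
  set s := 1 - t
  have hst : s + t = 1 := tsub_add_cancel_of_le ht1.le
  have hs : (s : ℝ) = 1 - t := NNReal.coe_sub ht1.le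
  refine ⟨s * γ₀ + t * γ₁, ?_, ?_, ?_⟩
  · rw [hs]
    nlinarith
  · rw [hs]
    nlinarith
  · refine lt_of_le_of_lt ?_ ht
    calc e * ∫⁻ ω, (C ω : ℝ≥0∞) ^ (s * γ₀ + t * γ₁) ∂P
        ≤ e * (s * ∫⁻ ω, (C ω : ℝ≥0∞) ^ γ₀ ∂P + t * ∫⁻ ω, (C ω : ℝ≥0∞) ^ γ₁ ∂P) := by
          gcongr
          exact lintegral_rpow_le_interpolate hC hpos (hpos.trans h01) hst
      _ = s * a + t * b := by ring
      _ ≤ 1 * a + t * b := by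
          gcongr
          exact_mod_cast tsub_le_self
      _ = _ := by rw [one_mul]

theorem natCast_rpow_le {γ β : ℝ} (h1 : 0 < γ) (h2 : γ ≤ β) (n : ℕ) :
    (n : ℝ≥0∞) ^ γ ≤ (n : ℝ≥0∞) ^ β := by
  rcases Nat.eq_zero_or_pos n with rfl | hn
  · simp [h1]
  · exact ENNReal.rpow_le_rpow_of_exponent_le (by exact_mod_cast hn) h2

theorem lintegral_rpow_ne_top_of_le [IsProbabilityMeasure P] {γ β : ℝ} (h1 : 0 ≤ γ) (h2 : γ ≤ β)
    (hCβ : ∫⁻ ω, (C ω : ℝ≥0∞) ^ β ∂P ≠ ∞) : ∫⁻ ω, (C ω : ℝ≥0∞) ^ γ ∂P ≠ ∞ := by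
  have hle : ∀ ω, (C ω : ℝ≥0∞) ^ γ ≤ 1 + (C ω : ℝ≥0∞) ^ β := fun ω => by
    rcases le_total (C ω : ℝ≥0∞) 1 with h | h
    · exact (ENNReal.rpow_le_one h h1).trans le_self_add
    · exact (ENNReal.rpow_le_rpow_of_exponent_le h h2).trans le_add_self
  refine ((lintegral_mono hle).trans_lt ?_).ne
  rw [lintegral_add_left measurable_const]
  simpa using hCβ.lt_top

end Interpolation

/-! ### Moments of the total weight by induction on the exponent -/

section Moments

variable {Ω : Type*} [MeasurableSpace Ω] {P : Measure Ω} [IsProbabilityMeasure P] {N : Ω → ℕ}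
  {C : Ω → ℝ≥0}

theorem boundedMoments_one (h : (∫⁻ ω, N ω ∂P) * ∫⁻ ω, C ω ∂P < 1) : BoundedMoments P N C 1 := by
  set ρ := (∫⁻ ω, N ω ∂P) * ∫⁻ ω, C ω ∂P
  have hfin : (1 - ρ)⁻¹ ≠ ∞ := ENNReal.inv_ne_top.2 (tsub_pos_of_lt h).ne'
  refine ⟨((1 - ρ)⁻¹).toNNReal, fun n Nt Ct hT => ?_⟩
  simp only [ENNReal.rpow_one, partialWeight]
  rw [ENNReal.coe_toNNReal hfin, lintegral_finsetSum _ fun k _ =>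
    measurable_levelSum k hT.measurable_N fun v _ => hT.measurable_C v]
  simp_rw [hT.lintegral_levelSum]
  rw [← ENNReal.tsum_geometric]
  exact ENNReal.sum_le_tsum _

/-- The factor (1 + t)^γ pays for splitting off the root's weight 1, and (1 + t)^(γ - 1) for the
leave-one-out step; both tend to 1 as t → 0. -/
theorem exists_scale_lt_one {r : ℝ≥0∞} (hr : r < 1) {γ : ℝ} :
    ∃ t : ℝ≥0, 0 < t ∧ ((1 + t : ℝ≥0) : ℝ≥0∞) ^ γ *
      (((1 + t : ℝ≥0) : ℝ≥0∞) ^ (γ - 1) * r) < 1 := by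
  have hc : ∀ p : ℝ, Tendsto (fun t : ℝ≥0 => ((1 + t : ℝ≥0) : ℝ≥0∞) ^ p) (𝓝 0) (𝓝 1) := by
    intro p
    have h1 : Continuous fun t : ℝ≥0 => ((1 + t : ℝ≥0) : ℝ≥0∞) ^ p :=
      ENNReal.continuous_rpow_const.comp (ENNReal.continuous_coe.comp (by fun_prop))
    simpa using h1.tendsto 0
  have h1 := ENNReal.Tendsto.mul (hc γ) (Or.inr (by simpa using hr.ne_top))
    (ENNReal.Tendsto.mul_const (b := r) (hc (γ - 1)) (Or.inr hr.ne_top)) (Or.inr (by simp))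
  simp only [one_mul] at h1
  have h2 : Tendsto _ (𝓝[>] (0 : ℝ≥0)) (𝓝 r) := h1.mono_left nhdsWithin_le_nhds
  obtain ⟨t, ht, ht0⟩ := ((h2.eventually_lt_const hr).and self_mem_nhdsWithin).exists
  exact ⟨t, ht0, ht⟩

/-- The recursion at the root gives E Z_{n+1}^γ ≤ q E Z_n^γ + D with q < 1, where D involves only
lower moments of the weights. The bound must hold for all trees at once, since the induction on `n`
applies it to the subtrees. -/
theorem BoundedMoments.step {γ : ℝ} (hγ : 1 < γ) (hNγ : ∫⁻ ω, (N ω : ℝ≥0∞) ^ γ ∂P ≠ ∞)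
    (hC : ∫⁻ ω, C ω ∂P ≠ ∞) (hCg : ∫⁻ ω, (C ω : ℝ≥0∞) ^ max (γ - 1) 1 ∂P ≠ ∞)
    (hρ : (∫⁻ ω, N ω ∂P) * ∫⁻ ω, (C ω : ℝ≥0∞) ^ γ ∂P < 1)
    (h₁ : BoundedMoments P N C 1) (hg : BoundedMoments P N C (max (γ - 1) 1)) :
    BoundedMoments P N C γ := by
  have hγ0 : 0 ≤ γ := by linarith
  obtain ⟨K₁, hK₁⟩ := h₁
  obtain ⟨K₂, hK₂⟩ := hg
  obtain ⟨t, ht, hq⟩ := exists_scale_lt_one hρ (γ := γ)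
  set eN := ∫⁻ ω, N ω ∂P
  set eCγ := ∫⁻ ω, (C ω : ℝ≥0∞) ^ γ ∂P
  set u := ((1 + t : ℝ≥0) : ℝ≥0∞)
  set u' := ((1 + t⁻¹ : ℝ≥0) : ℝ≥0∞)
  set b₁ := (∫⁻ ω, C ω ∂P) * K₁
  set b₂ := (∫⁻ ω, (C ω : ℝ≥0∞) ^ max (γ - 1) 1 ∂P) * K₂
  set ν := ∫⁻ ω, (N ω : ℝ≥0∞) ^ γ ∂P
  have hb₁ : b₁ ≠ ∞ := ENNReal.mul_ne_top hC ENNReal.coe_ne_top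
  have hb₂ : b₂ ≠ ∞ := ENNReal.mul_ne_top hCg ENNReal.coe_ne_top
  have hu : ∀ p : ℝ, 0 ≤ p → u ^ p ≠ ∞ := fun p hp =>
    ENNReal.rpow_ne_top_of_nonneg hp ENNReal.coe_ne_top
  have hu' : ∀ p : ℝ, 0 ≤ p → u' ^ p ≠ ∞ := fun p hp =>
    ENNReal.rpow_ne_top_of_nonneg hp ENNReal.coe_ne_top
  obtain ⟨q, hq'⟩ : ∃ q : ℝ≥0, (q : ℝ≥0∞) = _ := ⟨_, ENNReal.coe_toNNReal hq.ne_top⟩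
  have hDfin : u ^ γ * (u' ^ (γ - 1) * (b₁ * (ν * (1 + b₂)))) + u' ^ γ ≠ ∞ := by
    have := hu γ hγ0
    have := hu' (γ - 1) (by linarith)
    have := hu' γ hγ0
    finiteness
  obtain ⟨D, hD⟩ : ∃ D : ℝ≥0, (D : ℝ≥0∞) = _ := ⟨_, ENNReal.coe_toNNReal hDfin⟩
  have hq1 : q < 1 := by
    rw [← hq'] at hq
    exact_mod_cast hq
  -- The fixed point of the affine recursion `K ↦ q * K + D`.
  set K := D / (1 - q)
  have hK : q * K + D = K := by
    have h1 : K * (1 - q) = D := div_mul_cancel₀ _ (tsub_pos_of_lt hq1).ne'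
    calc q * K + D = K * (q + (1 - q)) := by rw [mul_add, h1, mul_comm]
      _ = K := by rw [add_tsub_cancel_of_le hq1.le, mul_one]
  -- Starts the induction: the partial weight for n = 0 is 1, and 1 ≤ D ≤ K.
  have hD1 : 1 ≤ (D : ℝ≥0∞) := by
    rw [hD]
    refine le_trans ?_ le_add_self
    exact ENNReal.one_le_rpow (by simp [u']) (by linarith)
  refine ⟨K, fun n => ?_⟩
  induction n with
  | zero =>
    intro Nt Ct _
    simp only [partialWeight, zero_add, Finset.range_one, Finset.sum_singleton, levelSum,
      ENNReal.one_rpow, lintegral_const, measure_univ, mul_one]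
    refine hD1.trans ?_
    have : D ≤ K := by
      rw [← hK]
      exact le_add_self
    exact_mod_cast this
  | succ n ih =>
    intro Nt Ct h
    have hF := measurableOffRoot_partialWeight (Ω := Ω) n
    have hy := h.measurable_childTerm hF
    set y := childTerm (partialWeight n) Nt Ct
    have h1 := lintegral_random_sum_rpow_le (h.measurable_N []) hy (h.indepFun_childTerm hF) hγ ht
      (a := eCγ * K) (b₁ := b₁) (b₂ := b₂)
      (fun i => by
        rw [h.lintegral_childTerm_rpow hF i hγ0]
        gcongr
        exact ih _ _ (h.subtree i))
      (fun i => by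
        have h2 := h.lintegral_childTerm_rpow hF i zero_le_one
        have h3 := hK₁ n _ _ (h.subtree i)
        simp only [ENNReal.rpow_one] at h2 h3
        rw [h2]
        exact mul_le_mul' le_rfl h3)
      (fun i => by
        rw [h.lintegral_childTerm_rpow hF i (by positivity)]
        exact mul_le_mul' le_rfl (hK₂ n _ _ (h.subtree i)))
    rw [h.lintegral_N_rpow, show ∫⁻ ω, (Nt [] ω : ℝ≥0∞) ∂P = eN by
      simpa using h.lintegral_N_rpow [] 1] at h1
    have hSm : Measurable fun ω => (∑ i ∈ Finset.range (Nt [] ω), y i ω) ^ γ :=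
      (measurable_sum_range (h.measurable_N []) hy).pow_const γ
    calc ∫⁻ ω, partialWeight (n + 1) (fun v => Nt v ω) (fun v => Ct v ω) ^ γ ∂P
        ≤ ∫⁻ ω, (u ^ γ * (∑ i ∈ Finset.range (Nt [] ω), y i ω) ^ γ + u' ^ γ) ∂P := by
          refine lintegral_mono fun ω => ?_
          rw [partialWeight_succ]
          have := ENNReal.add_rpow_le_scaled (∑ i ∈ Finset.range (Nt [] ω), y i ω) 1 ht hγ0
          rw [ENNReal.one_rpow, mul_one] at this
          exact this
      _ = u ^ γ * ∫⁻ ω, (∑ i ∈ Finset.range (Nt [] ω), y i ω) ^ γ ∂P + u' ^ γ := by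
          rw [lintegral_add_left (hSm.const_mul _), lintegral_const_mul _ hSm]
          simp
      _ ≤ u ^ γ * (u ^ (γ - 1) * (eN * (eCγ * K)) + u' ^ (γ - 1) * (b₁ * (ν * (1 + b₂)))) +
          u' ^ γ := by gcongr
      _ = q * K + D := by
          rw [hD, hq']
          ring
      _ = K := by exact_mod_cast hK

/-- Each step lowers the exponent to max(γ - 1, 1), so induction over unit intervals reaches β.
Convexity makes all intermediate exponents subcritical. -/
theorem boundedMoments (hC : Measurable C) {β : ℝ} (hβ : 1 ≤ β)
    (hNβ : ∫⁻ ω, (N ω : ℝ≥0∞) ^ β ∂P ≠ ∞) (hCβ : ∫⁻ ω, (C ω : ℝ≥0∞) ^ β ∂P ≠ ∞)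
    (hρ : (∫⁻ ω, N ω ∂P) * ∫⁻ ω, C ω ∂P < 1)
    (hρβ : (∫⁻ ω, N ω ∂P) * ∫⁻ ω, (C ω : ℝ≥0∞) ^ β ∂P < 1) : BoundedMoments P N C β := by
  have hCfin : ∀ γ, 1 ≤ γ → γ ≤ β → ∫⁻ ω, (C ω : ℝ≥0∞) ^ γ ∂P ≠ ∞ :=
    fun γ h1 h2 => lintegral_rpow_ne_top_of_le (by linarith) h2 hCβ
  have hind : ∀ k : ℕ, ∀ γ : ℝ, 1 ≤ γ → γ ≤ β → γ ≤ 1 + k → BoundedMoments P N C γ := by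
    intro k
    induction k with
    | zero =>
      intro γ h1 _ h3
      obtain rfl : γ = 1 := le_antisymm (by simpa using h3) h1
      exact boundedMoments_one hρ
    | succ k ih =>
      intro γ h1 h2 h3
      rcases eq_or_lt_of_le h1 with rfl | h1'
      · exact boundedMoments_one hρ
      push_cast at h3
      have hg1 : max (γ - 1) 1 ≤ β := max_le (by linarith) hβ
      refine BoundedMoments.step h1' ?_ ?_ ?_ ?_ (boundedMoments_one hρ)
        (ih _ (le_max_right _ _) hg1 (max_le (by linarith)
          (by linarith [Nat.cast_nonneg (α := ℝ) k])))
      · exact ((lintegral_mono fun ω => natCast_rpow_le (by linarith) h2 _).trans_lt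
          hNβ.lt_top).ne
      · simpa using hCfin 1 le_rfl hβ
      · exact hCfin _ (le_max_right _ _) hg1
      · exact mul_lintegral_rpow_lt_one hC one_pos h1 h2 (by simpa using hρ) hρβ
  obtain ⟨k, hk⟩ := exists_nat_ge β
  exact hind k β hβ le_rfl (by linarith)

theorem IsTreeFamily.lintegral_tsum_nodeWeight_rpow {Nt : List ℕ → Ω → ℕ}
    {Ct : List ℕ → Ω → ℝ≥0} (h : IsTreeFamily P N C Nt Ct) {γ : ℝ} (hγ : 0 < γ) :
    ∫⁻ ω, ∑' v, (nodeWeight (fun v => Nt v ω) (fun v => Ct v ω) v : ℝ≥0∞) ^ γ ∂P =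
      (1 - (∫⁻ ω, N ω ∂P) * ∫⁻ ω, (C ω : ℝ≥0∞) ^ γ ∂P)⁻¹ := by
  have h' := h.rpow γ
  simp_rw [tsum_nodeWeight_rpow _ _ hγ]
  rw [lintegral_tsum fun n => (measurable_levelSum n h'.measurable_N fun v _ =>
    h'.measurable_C v).aemeasurable]
  simp_rw [h'.lintegral_levelSum, ENNReal.coe_rpow_of_nonneg _ hγ.le]
  exact ENNReal.tsum_geometric _

end Moments

/-! ### Integrability and measurability of the node weights -/

section NodeWeight

variable {Ω : Type*} [MeasurableSpace Ω] {P : Measure Ω} {N : Ω → ℕ} {C : Ω → ℝ≥0}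
  {Nt : List ℕ → Ω → ℕ} {Ct : List ℕ → Ω → ℝ≥0}

theorem IsTreeFamily.lintegral_tsum_nodeWeight_rpow_ne_top
    (h : IsTreeFamily P N C Nt Ct) {β : ℝ} (hβ : 0 ≤ β)
    (hb : BoundedMoments P N C β) :
    ∫⁻ ω, (∑' v, (nodeWeight (fun v => Nt v ω) (fun v => Ct v ω) v : ℝ≥0∞)) ^ β ∂P ≠ ∞ := by
  obtain ⟨K, hK⟩ := hb
  simp_rw [tsum_nodeWeight]
  refine (lt_of_le_of_lt ?_ (ENNReal.coe_lt_top (r := K))).ne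
  have hm : ∀ n, Measurable fun ω => partialWeight n (fun v => Nt v ω) (fun v => Ct v ω) ^ β :=
    fun n => (measurable_partialWeight n h.measurable_N fun v _ => h.measurable_C v).pow_const β
  refine le_of_tendsto' (lintegral_tendsto_of_tendsto_of_monotone
    (fun n => (hm n).aemeasurable) ?_ ?_) fun n => hK n Nt Ct h
  · refine Eventually.of_forall fun ω n m hnm => ENNReal.rpow_le_rpow ?_ hβ
    exact Finset.sum_le_sum_of_subset (Finset.range_mono (by omega))
  · refine Eventually.of_forall fun ω => (ENNReal.continuous_rpow_const.tendsto _).comp ?_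
    -- The shift by one appears because `partialWeight n` contains n + 1 generations.
    exact (tendsto_add_atTop_iff_nat 1).2
      (ENNReal.summable.hasSum.tendsto_sum_nat)

theorem measurableSet_mem_generation (hN : ∀ v, Measurable (Nt v)) (n : ℕ) (v : List ℕ) :
    MeasurableSet {ω | v ∈ generation (fun u => Nt u ω) n} := by
  induction n generalizing v Nt with
  | zero => simp [generation]
  | succ n ih =>
    simp_rw [generation_succ, Finset.mem_biUnion, Finset.mem_image, Finset.mem_range]
    rcases v with _ | ⟨i, u⟩
    · simp
    · have h : {ω | ∃ a < Nt [] ω, ∃ b ∈ generation (fun v => Nt (a :: v) ω) n,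
          a :: b = i :: u} = {ω | i < Nt [] ω} ∩
            {ω | u ∈ generation (fun v => Nt (i :: v) ω) n} := by
        ext ω
        constructor
        · rintro ⟨a, ha, b, hb, hab⟩
          obtain ⟨rfl, rfl⟩ := List.cons.inj hab
          exact ⟨ha, hb⟩
        · rintro ⟨h1, h2⟩
          exact ⟨i, h1, u, h2, rfl⟩
      rw [h]
      exact (measurableSet_lt measurable_const (hN [])).inter (ih (fun v => hN _) u)

theorem measurable_nodeWeight (hN : ∀ v, Measurable (Nt v)) (hC : ∀ v, Measurable (Ct v))
    (v : List ℕ) : Measurable fun ω => nodeWeight (fun v => Nt v ω) (fun v => Ct v ω) v :=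
  Measurable.ite (measurableSet_mem_generation hN _ v)
    (Finset.measurable_fun_prod _ fun _ _ => hC _) measurable_const

end NodeWeight

/-! ### The tail of the total weight of the tree -/

theorem IsTreeFamily.tendsto_totalWeight {Ω : Type*} [MeasurableSpace Ω] {P : Measure Ω}
    [IsProbabilityMeasure P] {N : Ω → ℕ} {Q C : Ω → ℝ≥0} {Nt : List ℕ → Ω → ℕ}
    {Qt Ct : List ℕ → Ω → ℝ≥0} (hQ : Measurable Q) (hC : Measurable C)
    (h : IsTreeFamily P N C Nt Ct) (hQm : ∀ v, Measurable (Qt v))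
    (hQd : ∀ v, IdentDistrib (Qt v) Q P P) (hQi : iIndepFun Qt P)
    (hind : IndepFun (fun ω v => nodeWeight (fun v => Nt v ω) (fun v => Ct v ω) v)
      (fun ω v => Qt v ω) P)
    {α β : ℝ} (hα : 1 < α) (hαβ : α < β)
    (hF : RegularTail (fun x => P.real {ω | x < (Q ω : ℝ)}) α)
    (hNβ : ∫⁻ ω, (N ω : ℝ≥0∞) ^ β ∂P ≠ ∞) (hCβ : ∫⁻ ω, (C ω : ℝ≥0∞) ^ β ∂P ≠ ∞)
    (hρ : (∫⁻ ω, N ω ∂P) * ∫⁻ ω, C ω ∂P < 1)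
    (hρα : (∫⁻ ω, N ω ∂P) * ∫⁻ ω, (C ω : ℝ≥0∞) ^ α ∂P < 1) :
    Tendsto (fun x : ℝ≥0 => P {ω | (x : ℝ≥0∞) <
        totalWeight (fun v => Nt v ω) (fun v => Qt v ω) (fun v => Ct v ω)} / P {ω | x < Q ω})
      atTop (𝓝 (1 - (∫⁻ ω, N ω ∂P) * ∫⁻ ω, (C ω : ℝ≥0∞) ^ α ∂P)⁻¹) := by
  have hα0 : 0 < α := by linarith
  have hN : ∫⁻ ω, (N ω : ℝ≥0∞) ∂P ≠ ∞ := by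
    have hle : ∀ ω, (N ω : ℝ≥0∞) ≤ (N ω : ℝ≥0∞) ^ β := fun ω => by
      simpa using natCast_rpow_le one_pos (show 1 ≤ β by linarith) (N ω)
    exact ((lintegral_mono hle).trans_lt hNβ.lt_top).ne
  -- Subcriticality may fail at `β` itself; any exponent above `α` where it holds suffices.
  obtain ⟨γ, hγ1, hγ2, hργ⟩ := exists_mul_lintegral_rpow_lt_one hC hα0 hαβ hρα
    (ENNReal.mul_ne_top hN hCβ)
  have hNγ : ∫⁻ ω, (N ω : ℝ≥0∞) ^ γ ∂P ≠ ∞ :=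
    ((lintegral_mono fun ω => natCast_rpow_le (by linarith) hγ2 _).trans_lt hNβ.lt_top).ne
  have hCγ : ∫⁻ ω, (C ω : ℝ≥0∞) ^ γ ∂P ≠ ∞ := lintegral_rpow_ne_top_of_le (by linarith) hγ2 hCβ
  have hb := boundedMoments hC (by linarith) hNγ hCγ hρ hργ
  have hmain := hF.tendsto_weighted_sum hQ hα hγ1
    (measurable_nodeWeight h.measurable_N h.measurable_C)
    (h.lintegral_tsum_nodeWeight_rpow_ne_top (by linarith) hb) hQm hQi hQd hind
  rw [h.lintegral_tsum_nodeWeight_rpow hα0] at hmain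
  simpa only [totalWeight_eq_tsum] using hmain

/-! ### Passage to real integrals and the main theorem -/

theorem toReal_lintegral_rpow {Ω : Type*} [MeasurableSpace Ω] {P : Measure Ω} {C : Ω → ℝ≥0}
    (hC : AEMeasurable C P) {γ : ℝ} (hγ : 0 ≤ γ) :
    ∫ ω, (C ω : ℝ) ^ γ ∂P = (∫⁻ ω, (C ω : ℝ≥0∞) ^ γ ∂P).toReal := by
  rw [integral_eq_lintegral_of_nonneg_ae (Eventually.of_forall fun ω => by positivity)
    (by fun_prop)]
  congr 1
  refine lintegral_congr fun ω => ?_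
  rw [← ENNReal.ofReal_rpow_of_nonneg (NNReal.coe_nonneg _) hγ, ENNReal.ofReal_coe_nnreal]

theorem lintegral_rpow_ne_top_of_integrable {Ω : Type*} [MeasurableSpace Ω] {P : Measure Ω}
    {C : Ω → ℝ≥0} {γ : ℝ} (hγ : 0 ≤ γ) (h : Integrable (fun ω => (C ω : ℝ) ^ γ) P) :
    ∫⁻ ω, (C ω : ℝ≥0∞) ^ γ ∂P ≠ ∞ := by
  refine (lt_of_le_of_lt (le_of_eq (lintegral_congr fun ω => ?_)) h.lintegral_lt_top).ne
  rw [← ENNReal.ofReal_rpow_of_nonneg (NNReal.coe_nonneg _) hγ, ENNReal.ofReal_coe_nnreal]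

theorem theorem5
    {Ω : Type*} [MeasurableSpace Ω] (P : Measure Ω) [IsProbabilityMeasure P]
    -- the generic variables `N`, `Q`, `C`
    (N : Ω → ℕ) (Q C : Ω → ℝ≥0)
    -- their copies at the individuals of the tree
    (Nt : List ℕ → Ω → ℕ) (Qt Ct : List ℕ → Ω → ℝ≥0)
    (hN : ∀ v, IdentDistrib (Nt v) N P P)
    (hQ : ∀ v, IdentDistrib (Qt v) Q P P)
    (hC : ∀ v, IdentDistrib (Ct v) C P P)
    -- all the copies are mutually independent
    (hindep : iIndepFun
      (Sum.elim (fun v ω => (Nt v ω : ℝ≥0)) (Sum.elim Qt Ct) :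
        List ℕ ⊕ (List ℕ ⊕ List ℕ) → Ω → ℝ≥0) P)
    (α : ℝ) (hα : 1 < α) (L : ℝ → ℝ) (hL : SlowlyVarying L)
    (hQtail : ∀ x : ℝ, 0 < x → P.real {ω | x < (Q ω : ℝ)} = x ^ (-α) * L x)
    (ε : ℝ) (hε : 0 < ε)
    (hCmom : Integrable (fun ω => (C ω : ℝ) ^ (α + ε)) P)
    (hNmom : Integrable (fun ω => (N ω : ℝ) ^ (α + ε)) P)
    (ρ ρα : ℝ)
    (hρ : ρ = (∫ ω, (N ω : ℝ) ∂P) * ∫ ω, (C ω : ℝ) ∂P)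
    (hρα : ρα = (∫ ω, (N ω : ℝ) ∂P) * ∫ ω, (C ω : ℝ) ^ α ∂P)
    (hlt : max ρ ρα < 1) :
    (fun x : ℝ => P.real {ω | ENNReal.ofReal x <
        totalWeight (fun v => Nt v ω) (fun v => Qt v ω) (fun v => Ct v ω)})
      ~[atTop] (fun x : ℝ => (1 - ρα)⁻¹ * P.real {ω | x < (Q ω : ℝ)}) := by
  have hα0 : 0 < α := by linarith
  -- measurable versions of all the variables
  set Nm : List ℕ → Ω → ℕ := fun v => (hN v).aemeasurable_fst.mk (Nt v)
  set Qm : List ℕ → Ω → ℝ≥0 := fun v => (hQ v).aemeasurable_fst.mk (Qt v)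
  set Cm : List ℕ → Ω → ℝ≥0 := fun v => (hC v).aemeasurable_fst.mk (Ct v)
  have hNm : ∀ v, Measurable (Nm v) := fun v => (hN v).aemeasurable_fst.measurable_mk
  have hQm : ∀ v, Measurable (Qm v) := fun v => (hQ v).aemeasurable_fst.measurable_mk
  have hCm : ∀ v, Measurable (Cm v) := fun v => (hC v).aemeasurable_fst.measurable_mk
  have hNe : ∀ v, Nt v =ᵐ[P] Nm v := fun v => (hN v).aemeasurable_fst.ae_eq_mk
  have hQe : ∀ v, Qt v =ᵐ[P] Qm v := fun v => (hQ v).aemeasurable_fst.ae_eq_mk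
  have hCe : ∀ v, Ct v =ᵐ[P] Cm v := fun v => (hC v).aemeasurable_fst.ae_eq_mk
  have hNi : ∀ v, IdentDistrib (Nm v) N P P := fun v =>
    (IdentDistrib.of_ae_eq (hNm v).aemeasurable (hNe v).symm).trans (hN v)
  have hQi : ∀ v, IdentDistrib (Qm v) Q P P := fun v =>
    (IdentDistrib.of_ae_eq (hQm v).aemeasurable (hQe v).symm).trans (hQ v)
  have hCi : ∀ v, IdentDistrib (Cm v) C P P := fun v =>
    (IdentDistrib.of_ae_eq (hCm v).aemeasurable (hCe v).symm).trans (hC v)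
  set X : List ℕ ⊕ (List ℕ ⊕ List ℕ) → Ω → ℝ≥0 :=
    Sum.elim (fun v ω => (Nm v ω : ℝ≥0)) (Sum.elim Qm Cm)
  have hXm : ∀ k, Measurable (X k) := by
    rintro (v | v | v)
    · exact (measurable_from_top (f := fun n : ℕ => (n : ℝ≥0))).comp (hNm v)
    · exact hQm v
    · exact hCm v
  have hXi : iIndepFun X P := by
    refine hindep.congr ?_
    rintro (v | v | v)
    · exact (hNe v).fun_comp fun n : ℕ => (n : ℝ≥0)
    · exact hQe v
    · exact hCe v
  have htree : IsTreeFamily P (Nm []) (Cm []) Nm Cm :=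
    { measurable_N := hNm
      measurable_C := hCm
      ident_N := fun v => (hNi v).trans (hNi []).symm
      ident_C := fun v => (hCi v).trans (hCi []).symm
      indep := by
        have := hXi.precomp (g := Sum.map id Sum.inr)
          (Sum.map_injective.2 ⟨Function.injective_id, Sum.inr_injective⟩)
        convert this using 1
        funext k
        rcases k with k | k <;> rfl }
  have hQind : iIndepFun Qm P := hXi.precomp (g := fun v => Sum.inr (Sum.inl v))
    (Sum.inr_injective.comp Sum.inl_injective)
  have hind : IndepFun (fun ω v => nodeWeight (fun v => Nm v ω) (fun v => Cm v ω) v)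
      (fun ω v => Qm v ω) P := by
    -- `S` is the set of indices of the innovations; the node weights use only the others.
    set S : Set (List ℕ ⊕ (List ℕ ⊕ List ℕ)) := Set.range fun v => Sum.inr (Sum.inl v)
    refine indepFun_of_indexedSigma hXm hXi (S := Sᶜ) (T := S) disjoint_compl_left ?_ ?_
    · let _ := indexedSigma X Sᶜ
      refine measurable_pi_lambda _ fun v => measurable_nodeWeight (fun v => ?_) (fun v => ?_) v
      · have h1 := measurable_indexedSigma (X := X) (S := Sᶜ) (k := Sum.inl v) (by simp [S])
        convert Nat.measurable_floor.comp h1 using 1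
        funext ω
        simp [X]
      · exact measurable_indexedSigma (X := X) (S := Sᶜ) (k := Sum.inr (Sum.inr v)) (by simp [S])
    · let _ := indexedSigma X S
      exact measurable_pi_lambda _ fun v =>
        measurable_indexedSigma (X := X) (S := S) (k := Sum.inr (Sum.inl v)) ⟨v, rfl⟩
  -- moments
  set eN := ∫⁻ ω, (Nm [] ω : ℝ≥0∞) ∂P
  have hlN : ∀ γ : ℝ, ∫⁻ ω, (Nm [] ω : ℝ≥0∞) ^ γ ∂P = ∫⁻ ω, (N ω : ℝ≥0∞) ^ γ ∂P := fun γ =>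
    ((hNi []).comp (measurable_from_top (f := fun n : ℕ => (n : ℝ≥0∞) ^ γ))).lintegral_eq
  have hlC : ∀ γ : ℝ, ∫⁻ ω, (Cm [] ω : ℝ≥0∞) ^ γ ∂P = ∫⁻ ω, (C ω : ℝ≥0∞) ^ γ ∂P := fun γ =>
    ((hCi []).comp (show Measurable fun y : ℝ≥0 => (y : ℝ≥0∞) ^ γ by fun_prop)).lintegral_eq
  have hNβ : ∫⁻ ω, (Nm [] ω : ℝ≥0∞) ^ (α + ε) ∂P ≠ ∞ := by
    rw [hlN]
    have := lintegral_rpow_ne_top_of_integrable (C := fun ω => (N ω : ℝ≥0)) (γ := α + ε)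
      (by linarith) (by simpa using hNmom)
    simpa using this
  have hCβ : ∫⁻ ω, (Cm [] ω : ℝ≥0∞) ^ (α + ε) ∂P ≠ ∞ := by
    rw [hlC]
    exact lintegral_rpow_ne_top_of_integrable (by linarith) hCmom
  have hCfin : ∀ γ : ℝ, 0 ≤ γ → γ ≤ α + ε → ∫⁻ ω, (Cm [] ω : ℝ≥0∞) ^ γ ∂P ≠ ∞ :=
    fun γ h0 h1 => lintegral_rpow_ne_top_of_le h0 h1 hCβ
  have hNfin : eN ≠ ∞ := by
    have hle : ∀ ω, (Nm [] ω : ℝ≥0∞) ≤ (Nm [] ω : ℝ≥0∞) ^ (α + ε) := fun ω => by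
      simpa using natCast_rpow_le one_pos (show 1 ≤ α + ε by linarith) (Nm [] ω)
    exact ((lintegral_mono hle).trans_lt hNβ.lt_top).ne
  have hiN : ∫ ω, (N ω : ℝ) ∂P = eN.toReal := by
    have hNae : AEMeasurable (fun ω => (N ω : ℝ≥0)) P :=
      (measurable_from_top (f := fun n : ℕ => (n : ℝ≥0)))
        |>.comp_aemeasurable (hNi []).aemeasurable_snd
    have h1 := toReal_lintegral_rpow hNae zero_le_one
    have h2 := hlN 1
    simp only [ENNReal.rpow_one, Real.rpow_one, NNReal.coe_natCast, ENNReal.coe_natCast] at h1 h2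
    rw [h1, ← h2]
  have hiC : ∀ γ : ℝ, 0 ≤ γ →
      ∫ ω, (C ω : ℝ) ^ γ ∂P = (∫⁻ ω, (Cm [] ω : ℝ≥0∞) ^ γ ∂P).toReal := fun γ hγ => by
    rw [toReal_lintegral_rpow (hCi []).aemeasurable_snd hγ, hlC]
  -- Finiteness of the moments is essential: a divergent real integral is 0 by convention, so the
  -- real inequality alone would say nothing about the extended one.
  have hsub : ∀ γ : ℝ, 0 ≤ γ → γ ≤ α + ε → (∫ ω, (N ω : ℝ) ∂P) * ∫ ω, (C ω : ℝ) ^ γ ∂P < 1 →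
      eN * ∫⁻ ω, (Cm [] ω : ℝ≥0∞) ^ γ ∂P < 1 := by
    intro γ h0 h1 h2
    rw [hiN, hiC γ h0, ← ENNReal.toReal_mul] at h2
    rwa [← ENNReal.toReal_lt_toReal (ENNReal.mul_ne_top hNfin (hCfin γ h0 h1)) ENNReal.one_ne_top,
      ENNReal.toReal_one]
  have hρ1 : eN * ∫⁻ ω, Cm [] ω ∂P < 1 := by
    have := hsub 1 zero_le_one (by linarith) (by
      simpa [← hρ] using (le_max_left _ _).trans_lt hlt)
    simpa using this
  have hρα1 : eN * ∫⁻ ω, (Cm [] ω : ℝ≥0∞) ^ α ∂P < 1 :=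
    hsub α hα0.le (by linarith) (by
      rw [← hρα]
      exact (le_max_right _ _).trans_lt hlt)
  have hραeq : eN * ∫⁻ ω, (Cm [] ω : ℝ≥0∞) ^ α ∂P = ENNReal.ofReal ρα := by
    rw [hρα, hiN, hiC α hα0.le, ← ENNReal.toReal_mul,
      ENNReal.ofReal_toReal (hρα1.trans ENNReal.one_lt_top).ne]
  have hρα' : ρα < 1 := (le_max_right _ _).trans_lt hlt
  have hρα0 : 0 ≤ ρα := by
    rw [hρα]
    positivity
  -- the tail of `Q`
  have hQeq : ∀ x : ℝ, P.real {ω | x < (Qm [] ω : ℝ)} = P.real {ω | x < (Q ω : ℝ)} := fun x => by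
    rw [measureReal_def, measureReal_def]
    congr 1
    exact (hQi []).measure_mem_eq (s := {y : ℝ≥0 | x < (y : ℝ)})
      (measurableSet_lt measurable_const (by fun_prop))
  have hF : RegularTail (fun x => P.real {ω | x < (Qm [] ω : ℝ)}) α := by
    refine RegularTail.of_slowlyVarying hL (fun x y hxy => ?_) fun x hx => by
      rw [hQeq, hQtail x hx]
    exact measureReal_mono fun ω hω => lt_of_le_of_lt hxy (show y < (Qm [] ω : ℝ) from hω)
  have hmain := htree.tendsto_totalWeight (hQm []) (hCm []) hQm
    (fun v => (hQi v).trans (hQi []).symm) hQind hind hα (show α < α + ε by linarith) hF hNβ hCβ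
    hρ1 hρα1
  rw [hραeq, ← ENNReal.ofReal_one, ← ENNReal.ofReal_sub _ hρα0,
    ← ENNReal.ofReal_inv_of_pos (by linarith)] at hmain
  have hR : ∀ x : ℝ, P.real {ω | ENNReal.ofReal x <
      totalWeight (fun v => Nt v ω) (fun v => Qt v ω) (fun v => Ct v ω)} =
      P.real {ω | ENNReal.ofReal x <
        totalWeight (fun v => Nm v ω) (fun v => Qm v ω) (fun v => Cm v ω)} := by
    intro x
    refine measureReal_congr (eventuallyEq_set.2 ?_)
    filter_upwards [ae_all_iff.2 hNe, ae_all_iff.2 hQe, ae_all_iff.2 hCe] with ω h1 h2 h3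
    simp only [h1, h2, h3]
  have hmain' := (ENNReal.tendsto_toReal ENNReal.ofReal_ne_top).comp
    (hmain.comp (tendsto_real_toNNReal_atTop))
  have hinv : 0 < (1 - ρα)⁻¹ := inv_pos.2 (by linarith)
  rw [ENNReal.toReal_ofReal hinv.le] at hmain'
  have hpos : ∀ x : ℝ, 0 < x → 0 < P.real {ω | x < (Q ω : ℝ)} := fun x hx => by
    rw [← hQeq]
    exact hF.pos x hx
  rw [isEquivalent_iff_tendsto_one]
  · have h1 := hmain'.div_const (1 - ρα)⁻¹
    rw [div_self hinv.ne'] at h1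
    refine h1.congr' ?_
    filter_upwards [eventually_gt_atTop 0] with x hx
    simp only [Function.comp, Pi.div_apply, ENNReal.toReal_div]
    rw [hR, div_div, mul_comm (P {ω | _ < Qm [] ω}).toReal]
    congr 2
    rw [← hQeq, measureReal_def]
    congr 2
    ext ω
    simp only [Set.mem_ofPred_eq]
    exact Real.toNNReal_lt_iff_lt_coe hx.le
  · filter_upwards [eventually_gt_atTop 0] with x hx
    have := hpos x hx
    positivity
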